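/- Let $H=\Gamma_s(L^2(\mathbb R_+))=\bigoplus_{n\ge 0}L^2_{\rm sym}(\mathbb R_+^n)$ be the symmetric Fock space with exponential vectors $e(f)=\bigoplus_n f^{\otimes n}/\sqrt{n!}$, $f\in L^2(\mathbb R_+)$. Let $S_t$, $t\ge 0$, be the right shifts, $(S_tf)(x)=f(x-t)$ for $x>t$ and $(S_tf)(x)=0$ for $0\le x\le t$. (i) For every $t\ge 0$ there is a unique bounded operator $T_t$ on $H$ with $T_te(f)=e(S_tf)$ for all $f\in L^2(\mathbb R_+)$. Define the no-event (extinction) semigroup on $B(H)$ by $\mathcal T_t(X)=T_tXT_t^*$. (ii) For every $t\ge0$ there is a natural identification $\Gamma_s(L^2(0,t))\otimes\Gamma_s(L^2(t,+\infty))\cong H$ in which $\Gamma_s(L^2(t,+\infty))$ is identified with $H$ by the shift, that is, $e(f)\otimes e(g)\mapsto e(f+S_tg)$ for $f\in L^2(0,t)$, $g\in L^2(\mathbb R_+)$. For every $X\in B(H)$ let $\breve{\mathcal T}_t(X)\in B(H)$ be the operator, uniquely determined, which corresponds to ${\rm I}\otimes X$ (the "forgetting" semigroup). (iii) Let $H^\wedge=\mathbb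 C\Omega\oplus \big(H\otimes L^2(\mathbb R_+)\big)$, where $H\otimes L^2(\mathbb R_+)=L^2(\mathbb R_+;H)$. There is a unique unitary $W:H\to H^\wedge$ with $We(f)=\Omega\oplus\int_0^{+\infty}e(S_s^*f)\otimes\chi(ds)f$ for all $f\in L^2(\mathbb R_+)$; here $\chi(B)$ is the multiplication by the characteristic function of $B$, and the integral is the $H$-valued function $s\mapsto f(s)\,e(S_s^*f)$. For $Y\in B(H)$ and Borel $B\subseteq\mathbb R_+$, in particular for $B=[a,b)$, put $\mathfrak M(B)Y=W^{-1}\big(0\oplus (Y\otimes\chi(B))\big)W$. This is a finitely additive measure on $\mathbb R_+$ whose values are linear maps of $B(H)$ into itself. Then for every $t\ge 0$ and $X\in B(H)$ the integral $\int_0^t\mathfrak M(ds)\,\breve{\mathcal T}_{t-s}(X)$ exists, as the limit in the $w^*$-topology of $B(H)$ of the Riemann sums $\sum_i\mathfrak M([p_i,p_{i+1}))\,\breve{\mathcal T}_{t-\tau_i}(X)$ over all tagged partitions $0=p_0\le\dots\le p_n=t$, $p_i\le\tau_i\le p_{i+1}$, as the mesh tends to $0$, and $$\breve{\mathcal T}_t(X)-\int_0^t\mathfrak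 M(ds)\,\breve{\mathcal T}_{t-s}(X)=\mathcal T_t(X).$$ The same holds after transport by $W$: if $\Phi^\wedge(X)=W\,\Phi(W^{-1}XW)\,W^{-1}$ for a map $\Phi$ of $B(H)$ into itself, and $\mathfrak M^\wedge(B)=\mathfrak M(B)^\wedge$, then for every $t\ge0$ and $X\in B(H^\wedge)$ the integral below exists in the same sense in $B(H^\wedge)$, and $$\breve{\mathcal T}_t^\wedge(X)-\int_0^t\mathfrak M^\wedge(ds)\,\breve{\mathcal T}^\wedge_{t-s}(X)=\mathcal T_t^\wedge(X).$$ -/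

import Mathlib

open MeasureTheory Set
open scoped TensorProduct NNReal ENNReal InnerProductSpace

noncomputable section

namespace FockShift

theorem norm_sq_eq_integral {α : Type*} [MeasurableSpace α] {μ : Measure α} (g : Lp ℂ 2 μ) :
    ‖g‖ ^ 2 = ∫ x, ‖g x‖ ^ 2 ∂μ := by
  have h := L2.inner_def (𝕜 := ℂ) g g
  rw [inner_self_eq_norm_sq_to_K] at h
  have h2 : (∫ x, ⟪g x, g x⟫_ℂ ∂μ) = ((∫ x, ‖g x‖ ^ 2 ∂μ : ℝ) : ℂ) := by
    have h3 : (∫ x, ((‖g x‖ ^ 2 : ℝ) : ℂ) ∂μ) = ((∫ x, ‖g x‖ ^ 2 ∂μ : ℝ) : ℂ) :=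
      integral_ofReal
    rw [← h3]
    refine integral_congr_ae (Filter.Eventually.of_forall fun x => ?_)
    simp only [inner_self_eq_norm_sq_to_K]
    push_cast
    rfl
  rw [h2] at h
  have h4 : ((‖g‖ ^ 2 : ℝ) : ℂ) = ((∫ x, ‖g x‖ ^ 2 ∂μ : ℝ) : ℂ) := by
    rw [← h]
    push_cast
    rfl
  exact_mod_cast h4

section Fock

variable {α : Type*} [MeasurableSpace α] (μ : Measure α) [SigmaFinite μ]

theorem measurePreserving_perm {n : ℕ} (σ : Equiv.Perm (Fin n)) :
    MeasurePreserving (fun x : Fin n → α => fun i => x (σ i))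
      (Measure.pi fun _ => μ) (Measure.pi fun _ => μ) := by
  have h := measurePreserving_piCongrLeft (fun _ : Fin n => μ) σ.symm
  convert h using 1
  funext x i
  have := Equiv.piCongrLeft_apply_apply (fun _ : Fin n => α) σ.symm x (σ i)
  rw [Equiv.symm_apply_apply] at this
  exact this.symm

/-- The `n`-particle space over `L²(α, μ)`: the symmetric functions in `L²(αⁿ, μⁿ)`, that is
those fixed by every permutation of the coordinates. -/
def SymL2 (n : ℕ) : Submodule ℂ (Lp ℂ 2 (Measure.pi fun _ : Fin n => μ)) :=
  ⨅ σ : Equiv.Perm (Fin n),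
    LinearMap.eqLocus
      (Lp.compMeasurePreservingₗᵢ ℂ (fun x : Fin n → α => fun i => x (σ i))
        (measurePreserving_perm μ σ)).toLinearMap
      LinearMap.id

instance (n : ℕ) : CompleteSpace (SymL2 μ n) := by
  have h : IsClosed (SymL2 μ n : Set (Lp ℂ 2 (Measure.pi fun _ : Fin n => μ))) := by
    rw [SymL2, Submodule.coe_iInf]
    refine isClosed_iInter fun σ => ?_
    exact isClosed_eq (LinearIsometry.continuous _) continuous_id
  exact h.completeSpace_coe

/-- The symmetric (bosonic) Fock space `Γ_s(L²(α, μ))`: the Hilbert sum of the `n`-particle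
spaces, `n = 0, 1, 2, …`. -/
def Fock : Type _ := lp (fun n : ℕ => SymL2 μ n) 2

instance : NormedAddCommGroup (Fock μ) :=
  inferInstanceAs (NormedAddCommGroup (lp (fun n : ℕ => SymL2 μ n) 2))

instance : InnerProductSpace ℂ (Fock μ) :=
  inferInstanceAs (InnerProductSpace ℂ (lp (fun n : ℕ => SymL2 μ n) 2))

instance : CompleteSpace (Fock μ) :=
  inferInstanceAs (CompleteSpace (lp (fun n : ℕ => SymL2 μ n) 2))

variable {μ}

theorem memLp_tensorPow (f : Lp ℂ 2 μ) (n : ℕ) :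
    MemLp (fun x : Fin n → α => ∏ i, f (x i)) 2 (Measure.pi fun _ => μ) := by
  have hf := Lp.memLp f
  have hm : AEStronglyMeasurable (fun x : Fin n → α => ∏ i, f (x i)) (Measure.pi fun _ => μ) := by
    refine Finset.aestronglyMeasurable_fun_prod _ fun i _ => ?_
    exact hf.1.comp_quasiMeasurePreserving (Measure.quasiMeasurePreserving_eval _ i)
  rw [memLp_two_iff_integrable_sq_norm hm]
  have h := Integrable.fintype_prod (ι := Fin n) (μ := fun _ => μ)
    (f := fun _ x => ‖f x‖ ^ 2) (fun _ => (memLp_two_iff_integrable_sq_norm hf.1).1 hf)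
  refine h.congr (Filter.Eventually.of_forall fun x => ?_)
  simp only [norm_prod, Finset.prod_pow]

/-- The tensor power `f^{⊗n}`: the function `(x₁, …, xₙ) ↦ f(x₁) ⋯ f(xₙ)`. -/
def tensorPow (f : Lp ℂ 2 μ) (n : ℕ) : SymL2 μ n :=
  ⟨(memLp_tensorPow f n).toLp _, by
    rw [SymL2, Submodule.mem_iInf]
    intro σ
    rw [LinearMap.mem_eqLocus]
    change Lp.compMeasurePreserving _ (measurePreserving_perm μ σ) _ = _
    rw [Lp.toLp_compMeasurePreserving]
    change _ = (memLp_tensorPow f n).toLp _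
    refine MemLp.toLp_congr _ _ (Filter.Eventually.of_forall fun x => ?_)
    exact Equiv.prod_comp σ fun i => f (x i)⟩

theorem norm_tensorPow (f : Lp ℂ 2 μ) (n : ℕ) : ‖tensorPow f n‖ = ‖f‖ ^ n := by
  have h1 : ‖tensorPow f n‖ ^ 2 = (‖f‖ ^ n) ^ 2 := by
    change ‖(memLp_tensorPow f n).toLp _‖ ^ 2 = _
    rw [norm_sq_eq_integral, ← pow_mul, mul_comm, pow_mul, norm_sq_eq_integral f]
    have : ∫ x, ‖((memLp_tensorPow f n).toLp _ : Lp ℂ 2 (Measure.pi fun _ : Fin n => μ)) x‖ ^ 2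
          ∂(Measure.pi fun _ : Fin n => μ)
        = ∫ x : Fin n → α, ∏ i, ‖f (x i)‖ ^ 2 ∂(Measure.pi fun _ : Fin n => μ) := by
      refine integral_congr_ae ?_
      filter_upwards [(memLp_tensorPow f n).coeFn_toLp] with x hx
      rw [hx, norm_prod, Finset.prod_pow]
    rw [this, integral_fintype_prod_eq_pow (𝕜 := ℝ) (fun x => ‖f x‖ ^ 2), Fintype.card_fin]
  exact (pow_left_inj₀ (norm_nonneg _) (by positivity) two_ne_zero).1 h1

theorem memℓp_expVec (f : Lp ℂ 2 μ) :
    Memℓp (fun n : ℕ => ((Real.sqrt n.factorial : ℝ) : ℂ)⁻¹ • tensorPow f n) 2 := by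
  rw [memℓp_gen_iff (by norm_num)]
  refine (Real.summable_pow_div_factorial (‖f‖ ^ 2)).congr fun n => ?_
  have : (2 : ℝ≥0∞).toReal = ((2 : ℕ) : ℝ) := by norm_num
  rw [this, Real.rpow_natCast, norm_smul, norm_tensorPow, mul_pow, norm_inv, Complex.norm_real,
    inv_pow, Real.norm_of_nonneg (Real.sqrt_nonneg _), Real.sq_sqrt (by positivity)]
  ring

/-- The exponential vector `e(f) = ⊕ₙ f^{⊗n} / √(n!)`. -/
def expVec (f : Lp ℂ 2 μ) : Fock μ :=
  (⟨fun n : ℕ => ((Real.sqrt n.factorial : ℝ) : ℂ)⁻¹ • tensorPow f n, memℓp_expVec f⟩ :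
    lp (fun n : ℕ => SymL2 μ n) 2)

end Fock

/-- Lebesgue measure on the half-axis `ℝ₊ = [0, ∞)`. -/
abbrev halfLine : Measure ℝ := volume.restrict (Ici 0)

/-- `L²(ℝ₊)`. -/
abbrev L2Half : Type := Lp ℂ 2 halfLine

/-- `H = Γ_s(L²(ℝ₊))`. -/
abbrev H : Type := Fock halfLine

/-- Bounded operators on a Hilbert space. -/
abbrev Op (K : Type*) [NormedAddCommGroup K] [InnerProductSpace ℂ K] : Type _ := K →L[ℂ] K

/-! The semigroup of right shifts on `L²(ℝ₊)`. -/

theorem map_sub_le (t : ℝ≥0) :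
    Measure.map (fun x : ℝ => x - t) (halfLine.restrict (Ioi (t : ℝ))) ≤ halfLine := by
  have hm : Measurable (fun x : ℝ => x - t) := by fun_prop
  refine Measure.le_iff.2 fun s hs => ?_
  rw [Measure.map_apply hm hs, Measure.restrict_restrict measurableSet_Ioi,
    Measure.restrict_apply (hm hs), Measure.restrict_apply hs,
    ← (measurePreserving_sub_right volume (t : ℝ)).measure_preimage
      (hs.inter measurableSet_Ici).nullMeasurableSet]
  refine measure_mono fun x hx => ?_
  exact ⟨hx.1, by simpa using (le_of_lt hx.2.1 : (t : ℝ) ≤ x)⟩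

theorem quasi_sub (t : ℝ≥0) :
    Measure.QuasiMeasurePreserving (fun x : ℝ => x - t) (halfLine.restrict (Ioi (t : ℝ)))
      halfLine :=
  ⟨by fun_prop, (map_sub_le t).absolutelyContinuous⟩

theorem eLpNorm_shift_le (t : ℝ≥0) (f : L2Half) :
    eLpNorm (fun x : ℝ => if (t : ℝ) < x then f (x - t) else 0) 2 halfLine
      ≤ eLpNorm f 2 halfLine := by
  have h1 : (fun x : ℝ => if (t : ℝ) < x then f (x - t) else 0)
      = (Ioi (t : ℝ)).indicator (fun x => f (x - t)) := by
    funext x; simp [indicator]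
  rw [h1, eLpNorm_indicator_eq_eLpNorm_restrict measurableSet_Ioi]
  have h2 := eLpNorm_map_measure (p := 2) (f := fun x : ℝ => x - t) (g := f)
    (μ := halfLine.restrict (Ioi (t : ℝ)))
    ((Lp.aestronglyMeasurable f).mono_ac (map_sub_le t).absolutelyContinuous)
    (by fun_prop)
  change eLpNorm (f ∘ fun x : ℝ => x - t) 2 _ ≤ _
  rw [← h2]
  exact eLpNorm_mono_measure _ (map_sub_le t)

theorem memLp_shift (t : ℝ≥0) (f : L2Half) :
    MemLp (fun x : ℝ => if (t : ℝ) < x then f (x - t) else 0) 2 halfLine := by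
  refine ⟨?_, (eLpNorm_shift_le t f).trans_lt (Lp.memLp f).2⟩
  have h1 : (fun x : ℝ => if (t : ℝ) < x then f (x - t) else 0)
      = (Ioi (t : ℝ)).indicator (fun x => f (x - t)) := by
    funext x; simp [indicator]
  rw [h1, aestronglyMeasurable_indicator_iff measurableSet_Ioi]
  exact (Lp.aestronglyMeasurable f).comp_quasiMeasurePreserving (quasi_sub t)

/-- The right shift `S_t` on `L²(ℝ₊)`: `(S_t f)(x) = f(x - t)` for `x > t` and `0` for
`0 ≤ x ≤ t`. -/
def shift (t : ℝ≥0) : L2Half →L[ℂ] L2Half :=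
  LinearMap.mkContinuous
    { toFun := fun f => (memLp_shift t f).toLp _
      map_add' := fun f g => by
        rw [← MemLp.toLp_add]
        refine MemLp.toLp_congr _ _ ?_
        have h := (ae_restrict_iff' measurableSet_Ioi).1
          ((quasi_sub t).ae_eq_comp (Lp.coeFn_add f g))
        filter_upwards [h] with x hx
        by_cases hxt : (t : ℝ) < x
        · simpa [hxt] using hx hxt
        · simp [hxt]
      map_smul' := fun c f => by
        rw [RingHom.id_apply, ← MemLp.toLp_const_smul]
        refine MemLp.toLp_congr _ _ ?_
        have h := (ae_restrict_iff' measurableSet_Ioi).1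
          ((quasi_sub t).ae_eq_comp (Lp.coeFn_smul c f))
        filter_upwards [h] with x hx
        by_cases hxt : (t : ℝ) < x
        · simpa [hxt] using hx hxt
        · simp [hxt] }
    1 (fun f => by
      rw [one_mul]
      change ‖(memLp_shift t f).toLp _‖ ≤ ‖f‖
      rw [Lp.norm_toLp, Lp.norm_def]
      exact ENNReal.toReal_mono (Lp.memLp f).2.ne (eLpNorm_shift_le t f))

/-! The two semigroups on `B(H)`. -/

/-- `T` is the operator `T_t = Γ(S_t)` on `H`, the second quantisation of the shift `S_t`:
`T_t e(f) = e(S_t f)`. -/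
def IsFockShift (t : ℝ≥0) (T : Op H) : Prop :=
  ∀ f : L2Half, T (expVec f) = expVec (shift t f)

/-- The no-event (extinction) semigroup `𝒯_t(X) = T_t X T_t^*`. -/
def noEvent (T : ℝ≥0 → Op H) (t : ℝ≥0) (X : Op H) : Op H :=
  T t ∘L X ∘L ContinuousLinearMap.adjoint (T t)

/-- The space `Γ_s(L²(0,t))`. -/
abbrev FockInitial (t : ℝ≥0) : Type := Fock (volume.restrict (Ioo (0 : ℝ) t))

/-- Extension by zero `L²(0,t) → L²(ℝ₊)`. -/
def extendZero (t : ℝ≥0) (f : Lp ℂ 2 (volume.restrict (Ioo (0 : ℝ) t))) : L2Half :=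
  MemLp.toLp (p := 2) (μ := halfLine) ((Ioo (0 : ℝ) t).indicator f) (by
    rw [memLp_indicator_iff_restrict measurableSet_Ioo,
      Measure.restrict_restrict measurableSet_Ioo,
      inter_eq_left.2 (Ioo_subset_Ioi_self.trans Ioi_subset_Ici_self)]
    exact Lp.memLp f)

/-- `U` is the natural identification `Γ_s(L²(0,t)) ⊗ Γ_s(L²(t,∞)) ≅ H`, where `Γ_s(L²(t,∞))` is
identified with `H` by the shift: `U (e(f) ⊗ e(g)) = e(f + S_t g)`. It is given on the algebraic
tensor product (with its Hilbert tensor product norm), as an isometry with dense range; it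
extends to a unitary on the completion. -/
def IsFactorization (t : ℝ≥0) (U : (FockInitial t ⊗[ℂ] H) →ₗᵢ[ℂ] H) : Prop :=
  DenseRange U ∧
    ∀ (f : Lp ℂ 2 (volume.restrict (Ioo (0 : ℝ) t))) (g : L2Half),
      U (expVec f ⊗ₜ[ℂ] expVec g) = expVec (extendZero t f + shift t g)

/-- `Z` is `I ⊗ X` in the factorization `H = Γ_s(L²(0,t)) ⊗ Γ_s(L²(t,∞))`, the second factor
being identified with `H` by the shift. -/
def IsForgetting (t : ℝ≥0) (X Z : Op H) : Prop :=
  ∃ U : (FockInitial t ⊗[ℂ] H) →ₗᵢ[ℂ] H, IsFactorization t U ∧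
    ∀ (a : FockInitial t) (b : H), Z (U (a ⊗ₜ[ℂ] b)) = U (a ⊗ₜ[ℂ] X b)

/-! The space `H^ = ℂΩ ⊕ H ⊗ L²(ℝ₊)` and the unitary `W`. -/

/-- `H ⊗ L²(ℝ₊)`, realized as `L²(ℝ₊; H)`; `y ⊗ φ` is the function `s ↦ φ(s) y`. -/
abbrev HL2 : Type := Lp H 2 halfLine

/-- `H^ = ℂ ⊕ H ⊗ L²(ℝ₊)`, a Hilbert direct sum. -/
abbrev HHat : Type := WithLp 2 (ℂ × HL2)

/-- `W e(f) = Ω ⊕ ∫ e(S_s^* f) ⊗ χ(ds) f`; the second component is the `H`-valued function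
`s ↦ f(s) e(S_s^* f)`. -/
def IsW (W : H ≃ₗᵢ[ℂ] HHat) : Prop :=
  ∀ f : L2Half, (W (expVec f)).fst = 1 ∧
    (W (expVec f)).snd =ᵐ[halfLine]
      fun s : ℝ => f s • expVec (ContinuousLinearMap.adjoint (shift s.toNNReal) f)

/-! Operator-valued measures and the integral against them. -/

section OperatorMeasure

variable (K : Type*) [NormedAddCommGroup K] [InnerProductSpace ℂ K]

/-- A finitely additive measure on the Borel subsets of `ℝ₊`, with values in the linear maps of
`B(K)` into itself. It is defined on the Borel sets of `ℝ` and vanishes outside of `ℝ₊`. -/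
structure OperatorMeasure where
  toFun : ∀ B : Set ℝ, MeasurableSet B → (Op K →ₗ[ℂ] Op K)
  union : ∀ (B C : Set ℝ) (hB : MeasurableSet B) (hC : MeasurableSet C), Disjoint B C →
    toFun (B ∪ C) (hB.union hC) = toFun B hB + toFun C hC
  carrier : ∀ (B : Set ℝ) (hB : MeasurableSet B), Disjoint B (Ici 0) → toFun B hB = 0

/-- A tagged partition `0 = p₀ ≤ p₁ ≤ … ≤ pₙ = t` with tags `τᵢ ∈ [pᵢ, pᵢ₊₁]`. -/
structure TaggedPartition (t : ℝ≥0) where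
  n : ℕ
  point : ℕ → ℝ≥0
  tag : ℕ → ℝ≥0
  point_zero : point 0 = 0
  point_last : point n = t
  tag_mem : ∀ i < n, point i ≤ tag i ∧ tag i ≤ point (i + 1)

variable {K}

/-- The Riemann sum `∑ᵢ 𝔐([pᵢ, pᵢ₊₁)) F(τᵢ)`. -/
def riemannSum (M : OperatorMeasure K) (F : ℝ≥0 → Op K) {t : ℝ≥0} (P : TaggedPartition t) :
    Op K :=
  ∑ i ∈ Finset.range P.n, M.toFun (Ico (P.point i : ℝ) (P.point (i + 1))) measurableSet_Ico
    (F (P.tag i))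

/-- `A = ∫₀ᵗ 𝔐(ds) F(s)`, as the limit of the Riemann sums in the `w*`-topology of `B(K)` when the
mesh tends to zero. The `w*`-continuous functionals on `B(K)` are the functionals
`A ↦ ∑ₖ ⟪ξₖ, A ηₖ⟫` with square-summable sequences `ξ` and `η`. -/
def HasIntegral (M : OperatorMeasure K) (F : ℝ≥0 → Op K) (t : ℝ≥0) (A : Op K) : Prop :=
  ∀ ξ η : ℕ → K, (Summable fun k => ‖ξ k‖ ^ 2) → (Summable fun k => ‖η k‖ ^ 2) →
    ∀ ε : ℝ, 0 < ε → ∃ δ : ℝ, 0 < δ ∧ ∀ P : TaggedPartition t,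
      (∀ i < P.n, (P.point (i + 1) : ℝ) - P.point i < δ) →
        ‖∑' k, ⟪ξ k, riemannSum M F P (η k) - A (η k)⟫_ℂ‖ < ε

end OperatorMeasure

/-! Transport by `W`. -/

section Transport

variable {K K' : Type*} [NormedAddCommGroup K] [InnerProductSpace ℂ K]
  [NormedAddCommGroup K'] [InnerProductSpace ℂ K']

/-- `X ↦ W X W⁻¹`, as a map of `B(K)` into `B(K')`. -/
def conjBy (W : K ≃ₗᵢ[ℂ] K') : Op K →ₗ[ℂ] Op K' where
  toFun X := (W : K →L[ℂ] K') ∘L X ∘L (W.symm : K' →L[ℂ] K)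
  map_add' X Y := by ext; simp
  map_smul' c X := by ext; simp

/-- The isomorphic superoperator on `B(K')`: `X ↦ W (Φ (W⁻¹ X W)) W⁻¹`. -/
def transport (W : K ≃ₗᵢ[ℂ] K') (Φ : Op K → Op K) (X : Op K') : Op K' :=
  conjBy W (Φ (conjBy W.symm X))

/-- The isomorphic operator-valued measure on `B(K')`. -/
def OperatorMeasure.transport (W : K ≃ₗᵢ[ℂ] K') (M : OperatorMeasure K) :
    OperatorMeasure K' where
  toFun B hB := conjBy W ∘ₗ M.toFun B hB ∘ₗ conjBy W.symm
  union B C hB hC h := by rw [M.union B C hB hC h]; ext; simp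
  carrier B hB h := by rw [M.carrier B hB h]; ext; simp

end Transport

/-! The measure `𝔐`. -/

section TensorIndicator

variable {E : Type*} [NormedAddCommGroup E] [InnerProductSpace ℂ E]
  {α : Type*} [MeasurableSpace α] {μ : Measure α}

theorem memLp_tensorIndicator (Y : Op E) {B : Set α} (hB : MeasurableSet B) (u : Lp E 2 μ) :
    MemLp (B.indicator fun s => Y (u s)) 2 μ :=
  (Y.comp_memLp' (Lp.memLp u)).indicator hB

/-- The operator `Y ⊗ χ(B)` on `E ⊗ L²(μ) = L²(μ; E)`, with `χ(B)` the multiplication by the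
characteristic function of `B`: `((Y ⊗ χ(B)) u)(s) = χ_B(s) Y u(s)`. -/
def tensorIndicator (Y : Op E) {B : Set α} (hB : MeasurableSet B) : Op (Lp E 2 μ) :=
  LinearMap.mkContinuous
    { toFun := fun u => (memLp_tensorIndicator Y hB u).toLp _
      map_add' := fun u v => by
        rw [← MemLp.toLp_add]
        refine MemLp.toLp_congr _ _ ?_
        filter_upwards [Lp.coeFn_add u v] with s hs
        by_cases h : s ∈ B
        · simp only [h, indicator_of_mem, Pi.add_apply, hs, map_add]
        · simp [h]
      map_smul' := fun c u => by
        rw [RingHom.id_apply, ← MemLp.toLp_const_smul]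
        refine MemLp.toLp_congr _ _ ?_
        filter_upwards [Lp.coeFn_smul c u] with s hs
        by_cases h : s ∈ B
        · simp only [h, indicator_of_mem, Pi.smul_apply, hs, map_smul]
        · simp [h] }
    ‖Y‖ (fun u => by
      change ‖(memLp_tensorIndicator Y hB u).toLp _‖ ≤ _
      refine Lp.norm_le_mul_norm_of_ae_le_mul ?_
      filter_upwards [(memLp_tensorIndicator Y hB u).coeFn_toLp] with s hs
      rw [hs]
      by_cases h : s ∈ B
      · simpa [h] using Y.le_opNorm (u s)
      · simp only [h, not_false_eq_true, indicator_of_notMem, norm_zero]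
        positivity)

theorem coeFn_tensorIndicator (Y : Op E) {B : Set α} (hB : MeasurableSet B) (u : Lp E 2 μ) :
    tensorIndicator Y hB u =ᵐ[μ] B.indicator fun s => Y (u s) :=
  (memLp_tensorIndicator Y hB u).coeFn_toLp

theorem tensorIndicator_add (Y Z : Op E) {B : Set α} (hB : MeasurableSet B) :
    (tensorIndicator (Y + Z) hB : Op (Lp E 2 μ)) =
      tensorIndicator Y hB + tensorIndicator Z hB := by
  ext1 u
  refine Lp.ext ?_
  filter_upwards [coeFn_tensorIndicator (Y + Z) hB u, coeFn_tensorIndicator Y hB u,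
    coeFn_tensorIndicator Z hB u,
    Lp.coeFn_add (tensorIndicator Y hB u) (tensorIndicator Z hB u)] with s h1 h2 h3 h4
  refine h1.trans (Eq.trans ?_ h4.symm)
  rw [Pi.add_apply, h2, h3]
  by_cases h : s ∈ B <;> simp [h]

theorem tensorIndicator_smul (c : ℂ) (Y : Op E) {B : Set α} (hB : MeasurableSet B) :
    (tensorIndicator (c • Y) hB : Op (Lp E 2 μ)) = c • tensorIndicator Y hB := by
  ext1 u
  refine Lp.ext ?_
  filter_upwards [coeFn_tensorIndicator (c • Y) hB u, coeFn_tensorIndicator Y hB u,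
    Lp.coeFn_smul c (tensorIndicator Y hB u)] with s h1 h2 h3
  refine h1.trans (Eq.trans ?_ h3.symm)
  rw [Pi.smul_apply, h2]
  by_cases h : s ∈ B <;> simp [h]

theorem tensorIndicator_union (Y : Op E) {B C : Set α} (hB : MeasurableSet B)
    (hC : MeasurableSet C) (hd : Disjoint B C) :
    (tensorIndicator Y (hB.union hC) : Op (Lp E 2 μ)) =
      tensorIndicator Y hB + tensorIndicator Y hC := by
  ext1 u
  refine Lp.ext ?_
  filter_upwards [coeFn_tensorIndicator Y (hB.union hC) u, coeFn_tensorIndicator Y hB u,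
    coeFn_tensorIndicator Y hC u,
    Lp.coeFn_add (tensorIndicator Y hB u) (tensorIndicator Y hC u)] with s h1 h2 h3 h4
  refine h1.trans (Eq.trans ?_ h4.symm)
  rw [Pi.add_apply, h2, h3, indicator_union_of_disjoint hd]

theorem tensorIndicator_null (Y : Op E) {B : Set α} (hB : MeasurableSet B) (h0 : μ B = 0) :
    (tensorIndicator Y hB : Op (Lp E 2 μ)) = 0 := by
  ext1 u
  refine Lp.ext ?_
  filter_upwards [coeFn_tensorIndicator Y hB u, Lp.coeFn_zero E 2 μ,
    measure_eq_zero_iff_ae_notMem.1 h0] with s h1 h2 h3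
  refine h1.trans (Eq.trans ?_ h2.symm)
  rw [indicator_of_notMem h3, Pi.zero_apply]

end TensorIndicator

/-- The operator `0 ⊕ Z` on `ℂ ⊕ F`. -/
def zeroSum {F : Type*} [NormedAddCommGroup F] [InnerProductSpace ℂ F] :
    Op F →ₗ[ℂ] Op (WithLp 2 (ℂ × F)) where
  toFun Z := ((WithLp.prodContinuousLinearEquiv 2 ℂ ℂ F).symm : (ℂ × F) →L[ℂ] WithLp 2 (ℂ × F)) ∘L
    ContinuousLinearMap.inr ℂ ℂ F ∘L Z ∘L WithLp.sndL 2 ℂ ℂ F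
  map_add' X Y := by simp
  map_smul' c X := by simp

/-- The operator-valued measure `B ↦ (Y ↦ W⁻¹ (0 ⊕ (Y ⊗ χ(B))) W)` on `B(E)`, for a unitary
`W : E → ℂ ⊕ E ⊗ L²(ℝ₊)`. -/
def tensorMeasure {E : Type*} [NormedAddCommGroup E] [InnerProductSpace ℂ E]
    (W : E ≃ₗᵢ[ℂ] WithLp 2 (ℂ × Lp E 2 halfLine)) : OperatorMeasure E where
  toFun B hB :=
    { toFun := fun Y => conjBy W.symm (zeroSum (tensorIndicator Y hB))
      map_add' := fun Y Z => by rw [tensorIndicator_add, map_add, map_add]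
      map_smul' := fun c Y => by
        rw [tensorIndicator_smul, map_smul, map_smul, RingHom.id_apply] }
  union B C hB hC hd := by
    refine LinearMap.ext fun Y => ?_
    simp only [LinearMap.add_apply, LinearMap.coe_mk, AddHom.coe_mk]
    rw [tensorIndicator_union Y hB hC hd, map_add, map_add]
  carrier B hB hd := by
    refine LinearMap.ext fun Y => ?_
    simp only [LinearMap.zero_apply, LinearMap.coe_mk, AddHom.coe_mk]
    rw [tensorIndicator_null Y hB, map_zero, map_zero]
    rw [Measure.restrict_apply hB, hd.inter_eq, measure_empty]

/-- The measure `𝔐(B) Y = [0 ⊕ (Y ⊗ χ(B))]^∨ = W⁻¹ (0 ⊕ (Y ⊗ χ(B))) W` on `B(H)`. -/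
abbrev fockMeasure (W : H ≃ₗᵢ[ℂ] HHat) : OperatorMeasure H := tensorMeasure W

end FockShift

end

/-!
Everything is computed on exponential vectors. They satisfy `⟪e(f), e(g)⟫ = exp ⟪f, g⟫` and are
total (`eq_zero_of_inner_expVec`): a vector orthogonal to all `e(z f)` has all its components
orthogonal to the powers `f^{⊗n}`, hence, by polarization, to all products `f₁ ⊗ ⋯ ⊗ fₙ`, which are
total in `L²`. So `T_t`, the factorization `U` and `W` exist as soon as the prescribed images have
the right Gram matrix (`exists_linearIsometry_of_inner_eq`), and all operators involved are unique.
For `W` the Gram matrix is right because, with `k = conj f · g`,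
`1 + ∫₀^∞ k(s) exp(∫ₛ^∞ k) ds = exp(∫₀^∞ k)`, the fundamental theorem of calculus for
`s ↦ exp(∫ₛ^∞ k)`; and `W` is onto because a function orthogonal to all `s ↦ f(s) e(S_s^* f)`
vanishes (`eq_zero_of_inner_annihilated`).

Put `Φ(r) = ⟪e(S_r^* f), X e(S_r^* g)⟫`. The matrix elements of the forgetting semigroup are
`⟪e(f), (I ⊗ X) e(g)⟫ = exp(∫₀ᵗ k) Φ(t)`, those of the no-event semigroup are `Φ(t)`, and those of
`𝔐(B)(I ⊗ X)`, with the splitting at time `t - τ`, are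
`∫_B k(s) exp(∫ₛ^{s+t-τ} k) Φ(s+t-τ) ds`. For a fine partition `s + t - τ` is close to `t` on each
cell, so the Riemann sums tend to
`Φ(t) exp(-∫ₜ^∞ k) ∫₀ᵗ k(s) exp(∫ₛ^∞ k) ds = exp(∫₀ᵗ k) Φ(t) - Φ(t)`, by the same fundamental
theorem of calculus. This is the convergence of matrix elements between exponential vectors. Since
`𝔐` acts on disjoint cells by block-diagonal operators, the Riemann sums are bounded by `‖X‖`
(`norm_riemannSum_le`), and for bounded families convergence on a total set implies convergence in
the `w*`-topology (`tendsto_tsum_inner_of_dense_span`).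
-/

noncomputable section

namespace FockShift

open Filter Topology

/-! ### Exponential vectors are total in the Fock space -/

section ExponentialVectors

variable {α : Type*} [MeasurableSpace α] {μ : Measure α} [SigmaFinite μ]

theorem memLp_tensorProd {n : ℕ} (f : Fin n → Lp ℂ 2 μ) :
    MemLp (fun x : Fin n → α => ∏ i, f i (x i)) 2 (Measure.pi fun _ => μ) := by
  have hm : AEStronglyMeasurable (fun x : Fin n → α => ∏ i, f i (x i))
      (Measure.pi fun _ => μ) :=
    Finset.aestronglyMeasurable_fun_prod _ fun i _ =>
      (Lp.memLp (f i)).1.comp_quasiMeasurePreserving (Measure.quasiMeasurePreserving_eval _ i)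
  rw [memLp_two_iff_integrable_sq_norm hm]
  have h := Integrable.fintype_prod (ι := Fin n) (μ := fun _ => μ)
    (f := fun i x => ‖f i x‖ ^ 2)
    (fun i => (memLp_two_iff_integrable_sq_norm (Lp.memLp (f i)).1).1 (Lp.memLp (f i)))
  refine h.congr (Filter.Eventually.of_forall fun x => ?_)
  simp only [norm_prod, Finset.prod_pow]

/-- The function `(x₁, …, xₙ) ↦ f₁(x₁) ⋯ fₙ(xₙ)` as an element of `L²(αⁿ)`. -/
def tensorProd {n : ℕ} (f : Fin n → Lp ℂ 2 μ) : Lp ℂ 2 (Measure.pi fun _ : Fin n => μ) :=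
  (memLp_tensorProd f).toLp _

theorem coeFn_tensorProd {n : ℕ} (f : Fin n → Lp ℂ 2 μ) :
    tensorProd f =ᵐ[Measure.pi fun _ => μ] fun x => ∏ i, f i (x i) :=
  (memLp_tensorProd f).coeFn_toLp

theorem norm_tensorProd {n : ℕ} (f : Fin n → Lp ℂ 2 μ) : ‖tensorProd f‖ = ∏ i, ‖f i‖ := by
  have h1 : ‖tensorProd f‖ ^ 2 = (∏ i, ‖f i‖) ^ 2 := by
    rw [norm_sq_eq_integral, ← Finset.prod_pow]
    simp_rw [norm_sq_eq_integral (f _)]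
    rw [← integral_fintype_prod_eq_prod (𝕜 := ℝ) fun i x => ‖f i x‖ ^ 2]
    refine integral_congr_ae ?_
    filter_upwards [coeFn_tensorProd f] with x hx
    rw [hx, norm_prod, Finset.prod_pow]
  exact (pow_left_inj₀ (norm_nonneg _) (Finset.prod_nonneg fun _ _ => norm_nonneg _)
    two_ne_zero).1 h1

/-- The continuous multilinear map `(f₁, …, fₙ) ↦ f₁ ⊗ ⋯ ⊗ fₙ`. -/
def tensorProdMultilinear (μ : Measure α) [SigmaFinite μ] (n : ℕ) :
    ContinuousMultilinearMap ℂ (fun _ : Fin n => Lp ℂ 2 μ)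
      (Lp ℂ 2 (Measure.pi fun _ : Fin n => μ)) :=
  MultilinearMap.mkContinuous
    { toFun := tensorProd
      map_update_add' := by
        intro _ m i f g
        refine Lp.ext ?_
        have h := (Measure.quasiMeasurePreserving_eval (fun _ : Fin n => μ) i).ae_eq_comp
          (Lp.coeFn_add f g)
        filter_upwards [coeFn_tensorProd (Function.update m i (f + g)),
          coeFn_tensorProd (Function.update m i f), coeFn_tensorProd (Function.update m i g),
          Lp.coeFn_add (tensorProd (Function.update m i f)) (tensorProd (Function.update m i g)),
          h] with x h1 h2 h3 h4 h5
        rw [h4, Pi.add_apply, h1, h2, h3]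
        simp only [← Finset.mul_prod_erase _ _ (Finset.mem_univ i), Function.update_self]
        have h6 : ∀ k : Lp ℂ 2 μ, (∏ j ∈ Finset.univ.erase i, (Function.update m i k j) (x j))
            = ∏ j ∈ Finset.univ.erase i, (m j) (x j) := fun k =>
          Finset.prod_congr rfl fun j hj => by
            rw [Function.update_of_ne (Finset.ne_of_mem_erase hj)]
        have h7 : (f + g : Lp ℂ 2 μ) (x i) = f (x i) + g (x i) := h5
        rw [h6, h6, h6, h7, add_mul]
      map_update_smul' := by
        intro _ m i c f
        refine Lp.ext ?_
        have h := (Measure.quasiMeasurePreserving_eval (fun _ : Fin n => μ) i).ae_eq_comp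
          (Lp.coeFn_smul c f)
        filter_upwards [coeFn_tensorProd (Function.update m i (c • f)),
          coeFn_tensorProd (Function.update m i f),
          Lp.coeFn_smul c (tensorProd (Function.update m i f)), h] with x h1 h2 h4 h5
        rw [h4, Pi.smul_apply, h1, h2]
        simp only [← Finset.mul_prod_erase _ _ (Finset.mem_univ i), Function.update_self]
        have h6 : ∀ k : Lp ℂ 2 μ, (∏ j ∈ Finset.univ.erase i, (Function.update m i k j) (x j))
            = ∏ j ∈ Finset.univ.erase i, (m j) (x j) := fun k =>
          Finset.prod_congr rfl fun j hj => by
            rw [Function.update_of_ne (Finset.ne_of_mem_erase hj)]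
        have h7 : (c • f : Lp ℂ 2 μ) (x i) = c • f (x i) := h5
        rw [h6, h6, h7, smul_mul_assoc] }
    1 (fun f => by rw [one_mul]; exact (norm_tensorProd f).le)

theorem tensorProdMultilinear_apply {n : ℕ} (f : Fin n → Lp ℂ 2 μ) :
    tensorProdMultilinear μ n f = tensorProd f := rfl

theorem coe_tensorPow (f : Lp ℂ 2 μ) (n : ℕ) :
    (tensorPow f n : Lp ℂ 2 (Measure.pi fun _ : Fin n => μ)) = tensorProd fun _ => f := rfl

theorem compMeasurePreserving_tensorProd {n : ℕ} (σ : Equiv.Perm (Fin n))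
    (f : Fin n → Lp ℂ 2 μ) :
    Lp.compMeasurePreservingₗᵢ ℂ (fun x : Fin n → α => fun i => x (σ i))
      (measurePreserving_perm μ σ) (tensorProd fun i => f (σ i)) = tensorProd fun i => f i := by
  refine Lp.ext ?_
  have h1 := Lp.coeFn_compMeasurePreserving (tensorProd fun i => f (σ i))
    (measurePreserving_perm μ σ)
  have h2 := (measurePreserving_perm μ σ).quasiMeasurePreserving.ae_eq_comp
    (coeFn_tensorProd fun i => f (σ i))
  refine h1.trans (h2.trans ?_)
  filter_upwards [coeFn_tensorProd f] with x hx
  rw [hx]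
  exact Equiv.prod_comp σ fun i => f i (x i)

theorem inner_tensorProd_perm {n : ℕ} (y : SymL2 μ n) (σ : Equiv.Perm (Fin n))
    (f : Fin n → Lp ℂ 2 μ) :
    ⟪(y : Lp ℂ 2 (Measure.pi fun _ : Fin n => μ)), tensorProd fun i => f (σ i)⟫_ℂ
      = ⟪(y : Lp ℂ 2 (Measure.pi fun _ : Fin n => μ)), tensorProd f⟫_ℂ := by
  have hσ := LinearMap.mem_eqLocus.1 ((Submodule.mem_iInf _).1 y.2 σ)
  rw [← LinearIsometry.inner_map_map (Lp.compMeasurePreservingₗᵢ ℂ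
    (fun x : Fin n → α => fun i => x (σ i)) (measurePreserving_perm μ σ)),
    compMeasurePreserving_tensorProd]
  congr 1

/-- Polarization: a symmetric function orthogonal to all powers `f^{⊗n}` is orthogonal to all
products `f₁ ⊗ ⋯ ⊗ fₙ`. -/
theorem inner_tensorProd_eq_zero {n : ℕ} (y : SymL2 μ n)
    (h : ∀ f : Lp ℂ 2 μ, ⟪y, tensorPow f n⟫_ℂ = 0) (f : Fin n → Lp ℂ 2 μ) :
    ⟪(y : Lp ℂ 2 (Measure.pi fun _ : Fin n => μ)), tensorProd f⟫_ℂ = 0 := by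
  let φ : ContinuousMultilinearMap ℂ (fun _ : Fin n => Lp ℂ 2 μ) ℂ :=
    (innerSL ℂ (y : Lp ℂ 2 (Measure.pi fun _ : Fin n => μ))).compContinuousMultilinearMap
      (tensorProdMultilinear μ n)
  have hφ : ∀ g : Fin n → Lp ℂ 2 μ,
      φ g = ⟪(y : Lp ℂ 2 (Measure.pi fun _ : Fin n => μ)), tensorProd g⟫_ℂ := fun g => rfl
  have h0 : (fun g : Lp ℂ 2 μ => φ fun _ => g) = fun _ => 0 := funext fun g => h g
  have h1 := φ.iteratedFDeriv_comp_diagonal 0 f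
  rw [h0] at h1
  have h2 : ∀ σ : Equiv.Perm (Fin n), φ (fun i => f (σ i)) = φ f := fun σ =>
    inner_tensorProd_perm y σ f
  simp only [h2, Finset.sum_const, Finset.card_univ, Fintype.card_perm, Fintype.card_fin] at h1
  have h3 : (iteratedFDeriv ℂ n (fun _ : Lp ℂ 2 μ => (0 : ℂ)) 0) f = 0 := by
    rw [iteratedFDeriv_fun_zero]
    rfl
  rw [h3] at h1
  rw [← hφ]
  rcases smul_eq_zero.1 h1.symm with h4 | h4
  · exact absurd h4 (Nat.factorial_ne_zero n)
  · exact h4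

/-- The products `f₁ ⊗ ⋯ ⊗ fₙ` are total in `L²(αⁿ)`; the indicators of boxes suffice, since boxes
form a `π`-system generating the product `σ`-algebra. -/
theorem eq_zero_of_inner_tensorProd {n : ℕ} (y : Lp ℂ 2 (Measure.pi fun _ : Fin n => μ))
    (h : ∀ f : Fin n → Lp ℂ 2 μ, ⟪y, tensorProd f⟫_ℂ = 0) : y = 0 := by
  let ν : Measure (Fin n → α) := Measure.pi fun _ => μ
  have hbox : ∀ A : Fin n → Set α, (∀ i, MeasurableSet (A i)) → (∀ i, μ (A i) ≠ ∞) →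
      ∫ x in univ.pi A, y x ∂ν = 0 := by
    intro A hA hA'
    have hm : MeasurableSet (univ.pi A) := MeasurableSet.univ_pi hA
    have hfin : ν (univ.pi A) ≠ ∞ := by
      rw [Measure.pi_pi]
      exact ENNReal.prod_ne_top fun i _ => hA' i
    have h1 : tensorProd (fun i => indicatorConstLp 2 (hA i) (hA' i) (1 : ℂ))
        = indicatorConstLp 2 hm hfin (1 : ℂ) := by
      refine Lp.ext ?_
      have h2 : ∀ i, ∀ᵐ x : Fin n → α ∂ν, indicatorConstLp 2 (hA i) (hA' i) (1 : ℂ) (x i)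
          = (A i).indicator (fun _ => (1 : ℂ)) (x i) := fun i =>
        (Measure.quasiMeasurePreserving_eval (fun _ : Fin n => μ) i).ae_eq_comp
          indicatorConstLp_coeFn
      filter_upwards [coeFn_tensorProd fun i => indicatorConstLp 2 (hA i) (hA' i) (1 : ℂ),
        indicatorConstLp_coeFn (hs := hm) (hμs := hfin) (c := (1 : ℂ)) (p := 2),
        ae_all_iff.2 h2] with x hx1 hx2 hx3
      rw [hx1, hx2]
      simp only [hx3]
      by_cases hx : x ∈ univ.pi A
      · rw [indicator_of_mem hx]
        exact Finset.prod_eq_one fun i _ => indicator_of_mem (hx i (mem_univ i)) _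
      · rw [indicator_of_notMem hx]
        simp only [mem_univ_pi, not_forall] at hx
        obtain ⟨i, hi⟩ := hx
        exact Finset.prod_eq_zero (Finset.mem_univ i) (indicator_of_notMem hi _)
    rw [← L2.inner_indicatorConstLp_one hm hfin, ← h1, ← inner_conj_symm, h, map_zero]
  let Q : ℕ → Set (Fin n → α) := fun k => univ.pi fun _ => spanningSets μ k
  have hQm : ∀ k, MeasurableSet (Q k) := fun k =>
    MeasurableSet.univ_pi fun _ => measurableSet_spanningSets μ k
  have hQfin : ∀ k, ν (Q k) ≠ ∞ := fun k => by
    rw [Measure.pi_pi]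
    exact ENNReal.prod_ne_top fun i _ => (measure_spanningSets_lt_top μ k).ne
  have hQ : ⋃ k, Q k = univ := by
    rw [iUnion_univ_pi_of_monotone fun _ => monotone_spanningSets μ]
    simp [iUnion_spanningSets]
  have hint : ∀ k, IntegrableOn y (Q k) ν := fun k =>
    integrableOn_Lp_of_measure_ne_top y (by norm_num) (hQfin k)
  have hzero : ∀ k, ∀ A : Set (Fin n → α), MeasurableSet A →
      ∫ x in A, y x ∂(ν.restrict (Q k)) = 0 := by
    intro k A hA
    refine MeasurableSpace.induction_on_inter
      (C := fun A _ => ∫ x in A, y x ∂(ν.restrict (Q k)) = 0) generateFrom_pi.symm isPiSystem_pi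
      ?_ ?_ ?_ ?_ A hA
    · simp
    · intro A hA
      obtain ⟨B, hB, rfl⟩ := hA
      have hB' : ∀ i, MeasurableSet (B i) := fun i => hB i (mem_univ i)
      rw [Measure.restrict_restrict (MeasurableSet.univ_pi hB'), ← pi_inter_distrib]
      refine hbox _ (fun i => (hB' i).inter (measurableSet_spanningSets μ k)) fun i => ?_
      exact ((measure_mono inter_subset_right).trans_lt (measure_spanningSets_lt_top μ k)).ne
    · intro A hA ih
      have h1 := integral_add_compl hA (hint k)
      rw [ih, zero_add] at h1
      rw [h1]
      exact hbox _ (fun i => measurableSet_spanningSets μ k)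
        fun i => (measure_spanningSets_lt_top μ k).ne
    · intro A hd hA ih
      rw [integral_iUnion hA hd (hint k).integrableOn]
      simp [ih]
  rw [Lp.eq_zero_iff_ae_eq_zero]
  have h1 : ∀ᵐ x ∂(ν.restrict (⋃ k, Q k)), y x = 0 := by
    rw [ae_restrict_iUnion_iff]
    intro k
    exact (hint k).ae_eq_zero_of_forall_setIntegral_eq_zero fun s hs _ => hzero k s hs
  rwa [hQ, Measure.restrict_univ] at h1

theorem inner_tensorPow (f g : Lp ℂ 2 μ) (n : ℕ) :
    ⟪tensorPow f n, tensorPow g n⟫_ℂ = ⟪f, g⟫_ℂ ^ n := by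
  rw [Submodule.coe_inner, coe_tensorPow, coe_tensorPow, L2.inner_def, L2.inner_def]
  have h := integral_fintype_prod_eq_pow (𝕜 := ℂ) (ι := Fin n) (μ := μ) (fun x => ⟪f x, g x⟫_ℂ)
  rw [Fintype.card_fin] at h
  rw [← h]
  refine integral_congr_ae ?_
  filter_upwards [coeFn_tensorProd fun _ : Fin n => f, coeFn_tensorProd fun _ : Fin n => g]
    with x h1 h2
  rw [h1, h2]
  simp only [RCLike.inner_apply, map_prod, Finset.prod_mul_distrib]

/-- `inner_smul_right` for the inner product of `L²(αⁿ)` restricted to `SymL2`, stated with the scalar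
multiplication of the submodule. -/
theorem SymL2.inner_smul_right {n : ℕ} (c : ℂ) (x y : SymL2 μ n) :
    ⟪x, c • y⟫_ℂ = c * ⟪x, y⟫_ℂ :=
  _root_.inner_smul_right (E := Lp ℂ 2 (Measure.pi fun _ : Fin n => μ)) _ _ _

theorem SymL2.inner_smul_left {n : ℕ} (c : ℂ) (x y : SymL2 μ n) :
    ⟪c • x, y⟫_ℂ = starRingEnd ℂ c * ⟪x, y⟫_ℂ :=
  _root_.inner_smul_left (E := Lp ℂ 2 (Measure.pi fun _ : Fin n => μ)) _ _ _

/-- The `n`-particle component of a Fock space vector; `id` serves to view the vector as an element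
of the underlying `lp` space. -/
def component (x : Fock μ) (n : ℕ) : SymL2 μ n :=
  (id x : lp (fun n : ℕ => SymL2 μ n) 2) n

theorem component_expVec (f : Lp ℂ 2 μ) (n : ℕ) :
    component (expVec f) n = ((Real.sqrt n.factorial : ℝ) : ℂ)⁻¹ • tensorPow f n := rfl

theorem hasSum_inner_expVec (x : Fock μ) (f : Lp ℂ 2 μ) :
    HasSum (fun n : ℕ => ((Real.sqrt n.factorial : ℝ) : ℂ)⁻¹ *
      ⟪component x n, tensorPow f n⟫_ℂ) ⟪x, expVec f⟫_ℂ := by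
  have h : HasSum (fun n : ℕ => ⟪component x n, component (expVec f) n⟫_ℂ) ⟪x, expVec f⟫_ℂ :=
    lp.hasSum_inner (𝕜 := ℂ) (G := fun n : ℕ => SymL2 μ n) x (expVec f)
  have h1 : (fun n : ℕ => ⟪component x n, component (expVec f) n⟫_ℂ) = fun n : ℕ =>
      ((Real.sqrt n.factorial : ℝ) : ℂ)⁻¹ * ⟪component x n, tensorPow f n⟫_ℂ :=
    funext fun n => by rw [component_expVec, SymL2.inner_smul_right]
  rwa [h1] at h

theorem inner_expVec (f g : Lp ℂ 2 μ) : ⟪expVec f, expVec g⟫_ℂ = Complex.exp ⟪f, g⟫_ℂ := by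
  have h1 := hasSum_inner_expVec (expVec f) g
  have h2 := NormedSpace.expSeries_div_hasSum_exp (𝔸 := ℂ) ⟪f, g⟫_ℂ
  rw [Complex.exp_eq_exp_ℂ]
  have h3 : (fun n : ℕ => ((Real.sqrt n.factorial : ℝ) : ℂ)⁻¹ *
      ⟪component (expVec f) n, tensorPow g n⟫_ℂ) = fun n : ℕ => ⟪f, g⟫_ℂ ^ n / n.factorial := by
    funext n
    rw [component_expVec, SymL2.inner_smul_left, inner_tensorPow, ← mul_assoc, map_inv₀,
      Complex.conj_ofReal, ← mul_inv, ← Complex.ofReal_mul, Real.mul_self_sqrt (by positivity),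
      Complex.ofReal_natCast]
    ring
  rw [h3] at h1
  exact h1.unique h2

theorem tensorPow_smul (z : ℂ) (f : Lp ℂ 2 μ) (n : ℕ) :
    tensorPow (z • f) n = z ^ n • tensorPow f n := by
  refine Subtype.ext ?_
  have h := (tensorProdMultilinear μ n).map_smul_univ (fun _ => z) fun _ => f
  simpa [tensorProdMultilinear_apply, coe_tensorPow] using h

/-- The exponential vectors are total: no nonzero vector is orthogonal to all of them. -/
theorem eq_zero_of_inner_expVec (x : Fock μ) (h : ∀ f : Lp ℂ 2 μ, ⟪x, expVec f⟫_ℂ = 0) :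
    x = 0 := by
  have h1 : ∀ (f : Lp ℂ 2 μ) (n : ℕ), ⟪component x n, tensorPow f n⟫_ℂ = 0 := by
    intro f n
    -- `z ↦ ⟪x, e(z f)⟫` is a power series in `z` that vanishes identically.
    let a : ℕ → ℂ := fun n =>
      ((Real.sqrt n.factorial : ℝ) : ℂ)⁻¹ * ⟪component x n, tensorPow f n⟫_ℂ
    have h2 : HasFPowerSeriesAt (0 : ℂ → ℂ) (FormalMultilinearSeries.ofScalars ℂ a) 0 := by
      rw [hasFPowerSeriesAt_iff]
      refine Eventually.of_forall fun z => ?_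
      have h3 := hasSum_inner_expVec x (z • f)
      have h4 : (fun k : ℕ => ((Real.sqrt k.factorial : ℝ) : ℂ)⁻¹ *
          ⟪component x k, tensorPow (z • f) k⟫_ℂ)
            = fun k => z ^ k • (FormalMultilinearSeries.ofScalars ℂ a).coeff k := by
        funext k
        rw [FormalMultilinearSeries.coeff_ofScalars, tensorPow_smul, SymL2.inner_smul_right, smul_eq_mul]
        ring
      rwa [h, h4] at h3
    have h3 : a n = 0 := by
      rw [← FormalMultilinearSeries.coeff_ofScalars (𝕜 := ℂ) (p := a), h2.eq_zero]
      rfl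
    refine (mul_eq_zero.1 h3).resolve_left (inv_ne_zero ?_)
    exact_mod_cast (Real.sqrt_pos.2 (by positivity)).ne'
  have h2 : ∀ n, component x n = 0 := fun n =>
    Subtype.ext (eq_zero_of_inner_tensorProd _ (inner_tensorProd_eq_zero _ fun f => h1 f n))
  exact lp.ext (E := fun n : ℕ => SymL2 μ n) (funext h2)

theorem continuous_expVec : Continuous (expVec : Lp ℂ 2 μ → Fock μ) := by
  rw [continuous_iff_continuousAt]
  intro f
  rw [ContinuousAt, tendsto_iff_norm_sub_tendsto_zero]
  have h1 : ∀ g : Lp ℂ 2 μ, ‖expVec g - expVec f‖ = Real.sqrt (RCLike.re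
      (Complex.exp ⟪g, g⟫_ℂ - Complex.exp ⟪g, f⟫_ℂ - Complex.exp ⟪f, g⟫_ℂ
        + Complex.exp ⟪f, f⟫_ℂ)) := by
    intro g
    rw [norm_eq_sqrt_re_inner (𝕜 := ℂ)]
    congr 2
    rw [inner_sub_left, inner_sub_right, inner_sub_right]
    simp only [inner_expVec]
    ring
  have h2 : Continuous fun g : Lp ℂ 2 μ => Real.sqrt (RCLike.re
      (Complex.exp ⟪g, g⟫_ℂ - Complex.exp ⟪g, f⟫_ℂ - Complex.exp ⟪f, g⟫_ℂ
        + Complex.exp ⟪f, f⟫_ℂ)) := by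
    fun_prop
  simp_rw [h1]
  refine (h2.tendsto f).trans (le_of_eq ?_)
  simp

end ExponentialVectors

/-! ### Operators determined by a total family -/

section TotalFamily

variable {ι E F : Type*} [NormedAddCommGroup E] [InnerProductSpace ℂ E]
  [NormedAddCommGroup F] [InnerProductSpace ℂ F]

theorem dense_span_of_forall_inner [CompleteSpace E] {a : ι → E}
    (h : ∀ x : E, (∀ i, ⟪x, a i⟫_ℂ = 0) → x = 0) :
    Dense (Submodule.span ℂ (range a) : Set E) := by
  rw [Submodule.dense_iff_topologicalClosure_eq_top, Submodule.topologicalClosure_eq_top_iff,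
    Submodule.eq_bot_iff]
  intro x hx
  refine h x fun i => ?_
  rw [← inner_conj_symm, (Submodule.mem_orthogonal _ x).1 hx _
    (Submodule.subset_span (mem_range_self i)), map_zero]

/-- A total family `a` is carried by a linear isometry to any family `b` with the same Gram
matrix. -/
theorem exists_linearIsometry_of_inner_eq [CompleteSpace F] {a : ι → E} {b : ι → F}
    (ha : Dense (Submodule.span ℂ (range a) : Set E))
    (hab : ∀ i j, ⟪b i, b j⟫_ℂ = ⟪a i, a j⟫_ℂ) :
    ∃ V : E →ₗᵢ[ℂ] F, ∀ i, V (a i) = b i := by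
  have hdense : DenseRange (Finsupp.linearCombination ℂ a) := by
    have h1 : range (Finsupp.linearCombination ℂ a) = (Submodule.span ℂ (range a) : Set E) := by
      rw [← Finsupp.range_linearCombination]; rfl
    rw [DenseRange, h1]
    exact ha
  have hnorm : ∀ x : ι →₀ ℂ,
      ‖Finsupp.linearCombination ℂ b x‖ = ‖Finsupp.linearCombination ℂ a x‖ := by
    intro x
    rw [norm_eq_sqrt_re_inner (𝕜 := ℂ), norm_eq_sqrt_re_inner (𝕜 := ℂ)]
    simp only [Finsupp.linearCombination_apply, Finsupp.sum, sum_inner, inner_sum, inner_smul_left,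
      inner_smul_right, hab]
  let V := (Finsupp.linearCombination ℂ b).extendOfNorm (Finsupp.linearCombination ℂ a)
  have hV : ∀ x, V (Finsupp.linearCombination ℂ a x) = Finsupp.linearCombination ℂ b x :=
    LinearMap.extendOfNorm_eq hdense ⟨1, fun x => by rw [one_mul, hnorm]⟩
  refine ⟨⟨V.toLinearMap, fun y => ?_⟩, fun i => ?_⟩
  · refine hdense.induction_on (p := fun y => ‖V y‖ = ‖y‖) y
      (isClosed_eq V.continuous.norm continuous_norm) fun x => ?_
    rw [hV, hnorm]
  · simpa using hV (Finsupp.single i 1)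

theorem exists_linearIsometryEquiv_of_inner_eq [CompleteSpace E] [CompleteSpace F]
    {a : ι → E} {b : ι → F} (ha : Dense (Submodule.span ℂ (range a) : Set E))
    (hb : Dense (Submodule.span ℂ (range b) : Set F))
    (hab : ∀ i j, ⟪b i, b j⟫_ℂ = ⟪a i, a j⟫_ℂ) :
    ∃ V : E ≃ₗᵢ[ℂ] F, ∀ i, V (a i) = b i := by
  obtain ⟨V, hV⟩ := exists_linearIsometry_of_inner_eq ha hab
  have hsurj : Function.Surjective V := by
    have h1 : IsClosed (range V) := V.isometry.isClosedEmbedding.isClosed_range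
    have h2 : (Submodule.span ℂ (range b) : Set F) ⊆ range V := by
      have : Submodule.span ℂ (range b) ≤ LinearMap.range V.toLinearMap := by
        rw [Submodule.span_le]
        rintro _ ⟨i, rfl⟩
        exact ⟨a i, hV i⟩
      exact this
    rw [← range_eq_univ, ← h1.closure_eq]
    exact (hb.mono h2).closure_eq
  exact ⟨LinearIsometryEquiv.ofSurjective V hsurj, hV⟩

end TotalFamily

/-! ### Extensionality on exponential vectors -/

section ExponentialVectorsTotal

variable {α : Type*} [MeasurableSpace α] {μ : Measure α} [SigmaFinite μ]

theorem dense_span_expVec :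
    Dense (Submodule.span ℂ (range (expVec : Lp ℂ 2 μ → Fock μ)) : Set (Fock μ)) :=
  dense_span_of_forall_inner eq_zero_of_inner_expVec

theorem op_ext_expVec {F : Type*} [NormedAddCommGroup F] [InnerProductSpace ℂ F]
    {A B : Fock μ →L[ℂ] F} (h : ∀ f : Lp ℂ 2 μ, A (expVec f) = B (expVec f)) : A = B :=
  ContinuousLinearMap.ext_on dense_span_expVec (by rintro _ ⟨f, rfl⟩; exact h f)

theorem ext_inner_expVec {x y : Fock μ} (h : ∀ f : Lp ℂ 2 μ, ⟪expVec f, x⟫_ℂ = ⟪expVec f, y⟫_ℂ) :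
    x = y := by
  rw [← sub_eq_zero]
  refine eq_zero_of_inner_expVec _ fun f => ?_
  rw [← inner_conj_symm, inner_sub_right, h, sub_self, map_zero]

end ExponentialVectorsTotal

/-! ### The shifts and their adjoints -/

section Shifts

theorem coeFn_shift (t : ℝ≥0) (f : L2Half) :
    shift t f =ᵐ[halfLine] fun x : ℝ => if (t : ℝ) < x then f (x - t) else 0 :=
  (memLp_shift t f).coeFn_toLp

theorem measurePreserving_add_halfLine (t : ℝ≥0) :
    MeasurePreserving (fun x : ℝ => x + t) halfLine (volume.restrict (Ici (t : ℝ))) := by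
  have h := (measurePreserving_add_right volume (t : ℝ)).restrict_preimage
    (measurableSet_Ici (a := (t : ℝ)))
  simpa using h

theorem restrict_Ici_le_halfLine (t : ℝ≥0) : volume.restrict (Ici (t : ℝ)) ≤ halfLine :=
  Measure.restrict_mono (Ici_subset_Ici.2 t.2) le_rfl

theorem quasiMeasurePreserving_add_halfLine (t : ℝ≥0) :
    Measure.QuasiMeasurePreserving (fun x : ℝ => x + t) halfLine halfLine :=
  (measurePreserving_add_halfLine t).quasiMeasurePreserving.mono_right
    (restrict_Ici_le_halfLine t).absolutelyContinuous

theorem integral_halfLine_comp_add {E : Type*} [NormedAddCommGroup E] [NormedSpace ℝ E]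
    (t : ℝ≥0) (F : ℝ → E) :
    ∫ x, F (x + t) ∂halfLine = ∫ x in Ioi (t : ℝ), F x := by
  rw [(measurePreserving_add_halfLine t).integral_comp (measurableEmbedding_addRight _),
    integral_Ici_eq_integral_Ioi]

theorem memLp_comp_add (t : ℝ≥0) (f : L2Half) : MemLp (fun x : ℝ => f (x + t)) 2 halfLine :=
  ((Lp.memLp f).mono_measure (restrict_Ici_le_halfLine t)).comp_measurePreserving
    (measurePreserving_add_halfLine t)

theorem halfLine_restrict_Ioi (t : ℝ≥0) :
    halfLine.restrict (Ioi (t : ℝ)) = volume.restrict (Ioi (t : ℝ)) := by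
  rw [Measure.restrict_restrict measurableSet_Ioi,
    inter_eq_left.2
      (show Ioi (t : ℝ) ⊆ Ici 0 from fun x hx => t.2.trans (le_of_lt hx))]

/-- `(S_t^* f)(x) = f(x + t)`. -/
theorem coeFn_adjoint_shift (t : ℝ≥0) (f : L2Half) :
    ContinuousLinearMap.adjoint (shift t) f =ᵐ[halfLine] fun x : ℝ => f (x + t) := by
  have h : ContinuousLinearMap.adjoint (shift t) f = (memLp_comp_add t f).toLp _ := by
    refine ext_inner_right ℂ fun g => ?_
    rw [ContinuousLinearMap.adjoint_inner_left, L2.inner_def, L2.inner_def]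
    have h1 : ∫ x, ⟪f x, shift t g x⟫_ℂ ∂halfLine
        = ∫ x, (Ioi (t : ℝ)).indicator (fun x => ⟪f x, g (x - t)⟫_ℂ) x ∂halfLine := by
      refine integral_congr_ae ?_
      filter_upwards [coeFn_shift t g] with x hx
      rw [hx]
      by_cases hxt : (t : ℝ) < x <;> simp [hxt]
    rw [h1, integral_indicator measurableSet_Ioi, halfLine_restrict_Ioi,
      ← integral_halfLine_comp_add t]
    refine integral_congr_ae ?_
    filter_upwards [(memLp_comp_add t f).coeFn_toLp] with x hx
    rw [hx, add_sub_cancel_right]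
  rw [h]
  exact (memLp_comp_add t f).coeFn_toLp

theorem inner_adjoint_shift (t : ℝ≥0) (f g : L2Half) :
    ⟪ContinuousLinearMap.adjoint (shift t) f, ContinuousLinearMap.adjoint (shift t) g⟫_ℂ
      = ∫ x in Ioi (t : ℝ), ⟪f x, g x⟫_ℂ := by
  rw [L2.inner_def, ← integral_halfLine_comp_add t]
  refine integral_congr_ae ?_
  filter_upwards [coeFn_adjoint_shift t f, coeFn_adjoint_shift t g] with x h1 h2
  rw [h1, h2]

theorem adjoint_shift_shift (t : ℝ≥0) (f : L2Half) :
    ContinuousLinearMap.adjoint (shift t) (shift t f) = f := by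
  refine Lp.ext ?_
  have h := (quasiMeasurePreserving_add_halfLine t).ae_eq_comp (coeFn_shift t f)
  have h0 : ∀ᵐ x ∂halfLine, x ∈ Ioi (0 : ℝ) := by
    rw [halfLine, ← restrict_Ioi_eq_restrict_Ici]
    exact ae_restrict_mem measurableSet_Ioi
  filter_upwards [coeFn_adjoint_shift t (shift t f), h, h0] with x h1 h2 h3
  rw [h1]
  refine h2.trans ?_
  have h4 : (t : ℝ) < x + t := by simpa using h3
  simp [h4]

theorem inner_shift (t : ℝ≥0) (f g : L2Half) : ⟪shift t f, shift t g⟫_ℂ = ⟪f, g⟫_ℂ := by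
  rw [← ContinuousLinearMap.adjoint_inner_right, adjoint_shift_shift]

/-- `S_t S_t^*` is the multiplication by the characteristic function of `(t, ∞)`. -/
theorem coeFn_shift_adjoint_shift (t : ℝ≥0) (f : L2Half) :
    shift t (ContinuousLinearMap.adjoint (shift t) f)
      =ᵐ[halfLine] (Ioi (t : ℝ)).indicator f := by
  have h := (ae_restrict_iff' measurableSet_Ioi).1
    ((quasi_sub t).ae_eq_comp (coeFn_adjoint_shift t f))
  filter_upwards [coeFn_shift t (ContinuousLinearMap.adjoint (shift t) f), h] with x h1 h2
  rw [h1]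
  by_cases hxt : (t : ℝ) < x
  · rw [if_pos hxt, indicator_of_mem (mem_Ioi.2 hxt)]
    simpa using h2 hxt
  · simp [hxt]

theorem adjoint_shift_adjoint_shift (r s : ℝ≥0) (f : L2Half) :
    ContinuousLinearMap.adjoint (shift r) (ContinuousLinearMap.adjoint (shift s) f)
      = ContinuousLinearMap.adjoint (shift (s + r)) f := by
  refine Lp.ext ?_
  have h := (quasiMeasurePreserving_add_halfLine r).ae_eq_comp (coeFn_adjoint_shift s f)
  filter_upwards [coeFn_adjoint_shift r (ContinuousLinearMap.adjoint (shift s) f), h,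
    coeFn_adjoint_shift (s + r) f] with x h1 h2 h3
  rw [h1, h3]
  refine h2.trans ?_
  simp only [Function.comp_apply, NNReal.coe_add]
  congr 1
  ring

theorem shift_shift (r s : ℝ≥0) (f : L2Half) : shift s (shift r f) = shift (s + r) f := by
  refine ext_inner_left ℂ fun g => ?_
  rw [← ContinuousLinearMap.adjoint_inner_left, ← ContinuousLinearMap.adjoint_inner_left,
    adjoint_shift_adjoint_shift, ContinuousLinearMap.adjoint_inner_left]

/-- If `f` and `g` agree on `(s, ∞)` then `S_s^* f = S_s^* g`. -/
theorem adjoint_shift_congr (s : ℝ≥0) {f g : L2Half}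
    (h : ∀ᵐ x ∂halfLine, (s : ℝ) < x → f x = g x) :
    ContinuousLinearMap.adjoint (shift s) f = ContinuousLinearMap.adjoint (shift s) g := by
  have h1 : shift s (ContinuousLinearMap.adjoint (shift s) f)
      = shift s (ContinuousLinearMap.adjoint (shift s) g) := by
    refine Lp.ext ?_
    filter_upwards [coeFn_shift_adjoint_shift s f, coeFn_shift_adjoint_shift s g, h]
      with x h1 h2 h3
    rw [h1, h2]
    by_cases hx : (s : ℝ) < x
    · simp [hx, h3 hx]
    · simp [hx]
  rw [← adjoint_shift_shift s (ContinuousLinearMap.adjoint (shift s) f), h1, adjoint_shift_shift]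

/-- The adjoint shifts are strongly continuous. -/
theorem continuous_adjoint_shift (f : L2Half) :
    Continuous fun t : ℝ≥0 => ContinuousLinearMap.adjoint (shift t) f := by
  have hf : MemLp ((Ici (0 : ℝ)).indicator f) 2 volume :=
    (memLp_indicator_iff_restrict measurableSet_Ici).2 (Lp.memLp f)
  have hmp : ∀ t : ℝ≥0, MeasurePreserving (fun x : ℝ => x + t) volume volume := fun t =>
    measurePreserving_add_right volume (t : ℝ)
  let g : ℝ≥0 → C(ℝ, ℝ) := fun t => ⟨fun x : ℝ => x + t, by fun_prop⟩
  have hg : Continuous g :=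
    ((⟨fun p : ℝ≥0 × ℝ => p.2 + p.1, by fun_prop⟩ : C(ℝ≥0 × ℝ, ℝ)).curry).continuous
  have h1 : Continuous fun t : ℝ≥0 =>
      LpToLpRestrictCLM ℝ ℂ ℂ volume 2 (Ici 0) (Lp.compMeasurePreserving (g t) (hmp t) (hf.toLp _)) :=
    (ContinuousLinearMap.continuous _).comp
      (continuous_const.compMeasurePreservingLp hg hmp (by norm_num))
  convert h1 using 2 with t
  refine Lp.ext ?_
  have h2 := LpToLpRestrictCLM_coeFn ℂ (Ici (0 : ℝ))
    (Lp.compMeasurePreserving (g t) (hmp t) (hf.toLp _))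
  have h3 : ∀ᵐ x ∂halfLine, (Lp.compMeasurePreserving (g t) (hmp t) (hf.toLp _)) x
      = (hf.toLp _) (x + t) :=
    ae_restrict_of_ae (Lp.coeFn_compMeasurePreserving _ (hmp t))
  have h4 : ∀ᵐ x ∂halfLine, (hf.toLp _) (x + t) = (Ici (0 : ℝ)).indicator f (x + t) :=
    ae_restrict_of_ae ((hmp t).quasiMeasurePreserving.ae_eq_comp hf.coeFn_toLp)
  filter_upwards [coeFn_adjoint_shift t f, h2, h3, h4, ae_restrict_mem measurableSet_Ici]
    with x h5 h6 h7 h8 h9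
  rw [h5, h6, h7, h8, indicator_of_mem]
  exact add_nonneg h9 t.2

theorem adjoint_shift_zero (f : L2Half) : ContinuousLinearMap.adjoint (shift 0) f = f := by
  refine Lp.ext ?_
  filter_upwards [coeFn_adjoint_shift 0 f] with x hx
  rw [hx, NNReal.coe_zero, add_zero]

theorem tendsto_shift_zero (f : L2Half) : Tendsto (fun t : ℝ≥0 => shift t f) (𝓝 0) (𝓝 f) := by
  rw [tendsto_iff_norm_sub_tendsto_zero]
  have h1 : ∀ t : ℝ≥0, ‖shift t f - f‖ = Real.sqrt (RCLike.re
      (2 * ⟪f, f⟫_ℂ - ⟪f, ContinuousLinearMap.adjoint (shift t) f⟫_ℂ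
        - ⟪ContinuousLinearMap.adjoint (shift t) f, f⟫_ℂ)) := by
    intro t
    rw [norm_eq_sqrt_re_inner (𝕜 := ℂ)]
    congr 2
    rw [inner_sub_left, inner_sub_right, inner_sub_right, inner_shift,
      ContinuousLinearMap.adjoint_inner_left, ContinuousLinearMap.adjoint_inner_right]
    ring
  have h2 : Continuous fun t : ℝ≥0 => Real.sqrt (RCLike.re
      (2 * ⟪f, f⟫_ℂ - ⟪f, ContinuousLinearMap.adjoint (shift t) f⟫_ℂ
        - ⟪ContinuousLinearMap.adjoint (shift t) f, f⟫_ℂ)) := by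
    have := continuous_adjoint_shift f
    fun_prop
  simp_rw [h1]
  refine (h2.tendsto 0).trans (le_of_eq ?_)
  rw [adjoint_shift_zero]
  congr 1
  rw [show 2 * ⟪f, f⟫_ℂ - ⟪f, f⟫_ℂ - ⟪f, f⟫_ℂ = 0 by ring]
  simp

end Shifts

/-! ### The derivative of an exponential of an absolutely continuous function -/

section Calculus

/-- For integrable `k`, the function `x ↦ exp(-∫₀ˣ k)` is absolutely continuous with a.e.
derivative `-k exp(-∫₀ˣ k)`, and the fundamental theorem of calculus applies. -/
theorem integral_mul_exp_neg_integral {k : ℝ → ℂ} (hk : Integrable k) (T : ℝ) (hT : 0 ≤ T) :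
    ∫ s in (0 : ℝ)..T, k s * Complex.exp (-∫ x in (0 : ℝ)..s, k x)
      = 1 - Complex.exp (-∫ x in (0 : ℝ)..T, k x) := by
  let φ : ℝ → ℂ := fun s => ∫ x in (0 : ℝ)..s, k x
  have hki : ∀ a b : ℝ, IntervalIntegrable k volume a b := fun a b => hk.intervalIntegrable
  have hφ : Continuous φ := intervalIntegral.continuous_primitive hki 0
  have hE : Continuous fun s => Complex.exp (-φ s) := by fun_prop
  have hkE : ∀ a b : ℝ, IntervalIntegrable (fun s => k s * Complex.exp (-φ s)) volume a b :=
    fun a b => (hki a b).mul_continuousOn hE.continuousOn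
  let D : ℝ → ℂ := fun s => Complex.exp (-φ s) + ∫ x in (0 : ℝ)..s, k x * Complex.exp (-φ x)
  obtain ⟨M, hM⟩ := (isCompact_Icc (a := 0) (b := T)).exists_bound_of_continuousOn hφ.continuousOn
  obtain ⟨C, hC⟩ : ∃ C : ℝ, ∀ s ∈ Icc (0 : ℝ) T, ‖Complex.exp (-φ s)‖ ≤ C :=
    (isCompact_Icc (a := 0) (b := T)).exists_bound_of_continuousOn hE.continuousOn
  have hC0 : 0 ≤ C := (norm_nonneg _).trans (hC 0 ⟨le_rfl, hT⟩)
  obtain ⟨K, hK⟩ : ∃ K : ℝ≥0, LipschitzOnWith K (fun z : ℂ => Complex.exp (-z))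
      (Metric.closedBall 0 M) := by
    have h1 : ContDiffOn ℝ 1 (fun z : ℂ => Complex.exp (-z)) (Metric.closedBall 0 M) :=
      ((Complex.contDiff_exp (𝕜 := ℝ)).comp contDiff_neg).contDiffOn
    exact h1.exists_lipschitzOnWith (by decide) (convex_closedBall _ _)
      (isCompact_closedBall _ _)
  -- The increments of `D` are dominated by those of the primitive of `‖k‖`.
  have hbound : ∀ x ∈ Icc (0 : ℝ) T, ∀ y ∈ Icc (0 : ℝ) T,
      dist (D x) (D y) ≤ (K + C) * dist (∫ v in (0 : ℝ)..x, ‖k v‖) (∫ v in (0 : ℝ)..y, ‖k v‖) := by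
    have key : ∀ x ∈ Icc (0 : ℝ) T, ∀ y ∈ Icc (0 : ℝ) T, x ≤ y →
        dist (D x) (D y) ≤ (K + C) * dist (∫ v in (0 : ℝ)..x, ‖k v‖) (∫ v in (0 : ℝ)..y, ‖k v‖) := by
      intro x hx y hy hxy
      have h1 : dist (∫ v in (0 : ℝ)..x, ‖k v‖) (∫ v in (0 : ℝ)..y, ‖k v‖)
          = ∫ v in x..y, ‖k v‖ := by
        rw [dist_comm, Real.dist_eq, intervalIntegral.integral_interval_sub_left (hki _ _).norm
          (hki _ _).norm, abs_of_nonneg (intervalIntegral.integral_nonneg hxy fun _ _ => norm_nonneg _)]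
      have h2 : dist (φ x) (φ y) ≤ ∫ v in x..y, ‖k v‖ := by
        rw [dist_comm, dist_eq_norm, intervalIntegral.integral_interval_sub_left (hki _ _) (hki _ _)]
        exact intervalIntegral.norm_integral_le_integral_norm hxy
      have h3 : dist (Complex.exp (-φ x)) (Complex.exp (-φ y)) ≤ K * ∫ v in x..y, ‖k v‖ := by
        refine (hK.dist_le_mul (φ x) (by simpa using hM x hx) (φ y) (by simpa using hM y hy)).trans ?_
        gcongr
      have h4 : dist (∫ v in (0 : ℝ)..x, k v * Complex.exp (-φ v))
          (∫ v in (0 : ℝ)..y, k v * Complex.exp (-φ v)) ≤ C * ∫ v in x..y, ‖k v‖ := by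
        rw [dist_comm, dist_eq_norm,
          intervalIntegral.integral_interval_sub_left (hkE _ _) (hkE _ _),
          ← intervalIntegral.integral_const_mul]
        refine intervalIntegral.norm_integral_le_of_norm_le hxy ?_ ((hki _ _).norm.const_mul C)
        refine Eventually.of_forall fun v hv => ?_
        rw [norm_mul, mul_comm]
        gcongr
        exact hC v ⟨hx.1.trans hv.1.le, hv.2.trans hy.2⟩
      rw [h1, add_mul]
      exact (dist_add_add_le _ _ _ _).trans (add_le_add h3 h4)
    intro x hx y hy
    rcases le_total x y with h | h
    · exact key x hx y hy h
    · rw [dist_comm, dist_comm (∫ v in (0 : ℝ)..x, ‖k v‖)]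
      exact key y hy x hx h
  have hu : uIcc 0 T = Icc 0 T := uIcc_of_le hT
  have hN : AbsolutelyContinuousOnInterval (fun x => ∫ v in (0 : ℝ)..x, ‖k v‖) 0 T :=
    (hki 0 T).norm.absolutelyContinuousOnInterval_intervalIntegral (by simp)
  have hD : AbsolutelyContinuousOnInterval D 0 T := by
    rw [absolutelyContinuousOnInterval_iff] at hN ⊢
    intro ε hε
    have hpos : (0 : ℝ) < K + C + 1 := by positivity
    obtain ⟨δ, hδ, h⟩ := hN (ε / (K + C + 1)) (by positivity)
    refine ⟨δ, hδ, fun E hE1 hE2 => ?_⟩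
    have h5 := h E hE1 hE2
    have h6 : ∀ i ∈ Finset.range E.1, dist (D (E.2 i).1) (D (E.2 i).2) ≤ (K + C + 1) *
        dist (∫ v in (0 : ℝ)..(E.2 i).1, ‖k v‖) (∫ v in (0 : ℝ)..(E.2 i).2, ‖k v‖) := by
      intro i hi
      have h7 := hE1.1 i hi
      rw [hu] at h7
      refine (hbound _ h7.1 _ h7.2).trans ?_
      exact mul_le_mul_of_nonneg_right (by linarith) dist_nonneg
    refine (Finset.sum_le_sum h6).trans_lt ?_
    rw [← Finset.mul_sum]
    calc (K + C + 1 : ℝ) * _ < (K + C + 1) * (ε / (K + C + 1)) := by gcongr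
      _ = ε := by field_simp
  have hderiv : ∀ᵐ x, x ∈ uIcc 0 T → HasDerivAt D 0 x := by
    filter_upwards [(hki 0 T).ae_hasDerivAt_integral, (hkE 0 T).ae_hasDerivAt_integral]
      with x h1 h2 hx
    have h3 : HasDerivAt φ (k x) x := h1 hx 0 (by simp)
    have h4 := h3.neg.cexp.add (h2 hx 0 (by simp))
    have h5 : Complex.exp (-φ x) * -k x + k x * Complex.exp (-φ x) = 0 := by ring
    exact h4.congr_deriv h5
  obtain ⟨c, hc⟩ := hD.const_of_ae_hasDerivAt_zero hderiv
  have h0 := hc 0 (by simp)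
  have h1 := hc T (by simp)
  have h2 : D T = D 0 := h1.trans h0.symm
  simp only [D, φ, intervalIntegral.integral_same, neg_zero, Complex.exp_zero, add_zero] at h2
  rw [← h2]
  ring

theorem integral_eq_integral_Ioi_sub {k : ℝ → ℂ} (hk : Integrable k) (s : ℝ) :
    -∫ x in (0 : ℝ)..s, k x = (∫ x in Ioi s, k x) - ∫ x in Ioi (0 : ℝ), k x := by
  have h := intervalIntegral.integral_Ioi_sub_Ioi' (a := 0) (b := s) hk.integrableOn hk.integrableOn
  rw [← h]
  ring

/-- `∫₀ᵀ k(s) exp(∫_s^∞ k) ds = exp(∫_0^∞ k) - exp(∫_T^∞ k)`. -/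
theorem integral_mul_exp_tail {k : ℝ → ℂ} (hk : Integrable k) {T : ℝ} (hT : 0 ≤ T) :
    ∫ s in (0 : ℝ)..T, k s * Complex.exp (∫ x in Ioi s, k x)
      = Complex.exp (∫ x in Ioi (0 : ℝ), k x) - Complex.exp (∫ x in Ioi T, k x) := by
  have h := integral_mul_exp_neg_integral hk T hT
  simp only [integral_eq_integral_Ioi_sub hk, Complex.exp_sub, mul_div_assoc'] at h
  rw [intervalIntegral.integral_div] at h
  have h1 := Complex.exp_ne_zero (∫ x in Ioi (0 : ℝ), k x)
  field_simp at h
  exact h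

theorem tendsto_integral_Ioi_atTop {k : ℝ → ℂ} (hk : Integrable k) :
    Tendsto (fun T : ℝ => ∫ x in Ioi T, k x) atTop (𝓝 0) := by
  have h := intervalIntegral_tendsto_integral_Ioi 0 hk.integrableOn tendsto_id
  have h1 : ∀ T : ℝ, ∫ x in Ioi T, k x
      = (∫ x in Ioi (0 : ℝ), k x) - ∫ x in (0 : ℝ)..T, k x := by
    intro T
    linear_combination -(integral_eq_integral_Ioi_sub hk T)
  rw [funext h1]
  simpa using h.const_sub (∫ x in Ioi (0 : ℝ), k x)

theorem continuous_integral_Ioi {k : ℝ → ℂ} (hk : Integrable k) :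
    Continuous fun s : ℝ => ∫ x in Ioi s, k x := by
  have h1 : ∀ T : ℝ, ∫ x in Ioi T, k x
      = (∫ x in Ioi (0 : ℝ), k x) - ∫ x in (0 : ℝ)..T, k x := by
    intro T
    linear_combination -(integral_eq_integral_Ioi_sub hk T)
  rw [funext h1]
  exact continuous_const.sub
    (intervalIntegral.continuous_primitive (fun _ _ => hk.intervalIntegrable) 0)

theorem norm_integral_Ioi_le {k : ℝ → ℂ} (hk : Integrable k) (s : ℝ) :
    ‖∫ x in Ioi s, k x‖ ≤ ∫ x, ‖k x‖ :=
  (norm_integral_le_integral_norm _).trans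
    (setIntegral_le_integral hk.norm (Eventually.of_forall fun _ => norm_nonneg _))

theorem integrable_mul_exp_tail {k : ℝ → ℂ} (hk : Integrable k) :
    Integrable fun s => k s * Complex.exp (∫ x in Ioi s, k x) := by
  refine hk.mul_bdd (c := Real.exp (∫ x, ‖k x‖))
    (Complex.continuous_exp.comp (continuous_integral_Ioi hk)).aestronglyMeasurable ?_
  refine Eventually.of_forall fun s => ?_
  rw [Complex.norm_exp]
  exact Real.exp_le_exp.2 ((Complex.re_le_norm _).trans (norm_integral_Ioi_le hk s))

/-- `∫_0^∞ k(s) exp(∫_s^∞ k) ds = exp(∫_0^∞ k) - 1`. -/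
theorem integral_Ioi_mul_exp_tail {k : ℝ → ℂ} (hk : Integrable k) :
    ∫ s in Ioi (0 : ℝ), k s * Complex.exp (∫ x in Ioi s, k x)
      = Complex.exp (∫ x in Ioi (0 : ℝ), k x) - 1 := by
  have h1 := intervalIntegral_tendsto_integral_Ioi 0 (integrable_mul_exp_tail hk).integrableOn
    tendsto_id
  have h2 : Tendsto (fun T : ℝ => Complex.exp (∫ x in Ioi (0 : ℝ), k x)
      - Complex.exp (∫ x in Ioi T, k x)) atTop
      (𝓝 (Complex.exp (∫ x in Ioi (0 : ℝ), k x) - 1)) := by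
    have h3 := (Complex.continuous_exp.tendsto 0).comp (tendsto_integral_Ioi_atTop hk)
    rw [Complex.exp_zero] at h3
    exact h3.const_sub _
  refine tendsto_nhds_unique (h1.congr' ?_) h2
  filter_upwards [eventually_ge_atTop (0 : ℝ)] with T hT
  exact integral_mul_exp_tail hk hT

/-- An integrable function on the half-axis with vanishing integrals over all half-lines is zero. -/
theorem ae_eq_zero_of_forall_integral_Ioi {k : ℝ → ℂ} (hk : Integrable k)
    (h : ∀ a : ℝ, 0 ≤ a → ∫ x in Ioi a, k x = 0) : ∀ᵐ x ∂halfLine, k x = 0 := by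
  have h1 : ∀ a : ℝ, 0 ≤ a → ∫ x in (0 : ℝ)..a, k x = 0 := by
    intro a ha
    have h2 := integral_eq_integral_Ioi_sub hk a
    rw [h a ha, h 0 le_rfl, sub_zero, neg_eq_zero] at h2
    exact h2
  have h2 : ∀ n : ℕ, ∀ᵐ x : ℝ, x ∈ Ioo (0 : ℝ) n → k x = 0 := by
    intro n
    filter_upwards [(hk.intervalIntegrable (a := 0) (b := n)).ae_hasDerivAt_integral] with x hx hxn
    have h3 := hx (by rw [uIcc_of_le n.cast_nonneg]; exact Ioo_subset_Icc_self hxn) 0 (by simp)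
    refine h3.unique ((hasDerivAt_const x (0 : ℂ)).congr_of_eventuallyEq ?_)
    filter_upwards [lt_mem_nhds hxn.1] with y hy
    exact h1 y hy.le
  rw [halfLine, ← restrict_Ioi_eq_restrict_Ici, ae_restrict_iff' measurableSet_Ioi]
  filter_upwards [ae_all_iff.2 h2] with x hx hx0
  obtain ⟨n, hn⟩ := exists_nat_gt x
  exact hx n ⟨hx0, hn⟩

end Calculus

/-! ### The unitary `W` -/

section UnitaryW

theorem norm_adjoint_shift_le (t : ℝ≥0) (f : L2Half) :
    ‖ContinuousLinearMap.adjoint (shift t) f‖ ≤ ‖f‖ := by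
  have h : ‖shift t‖ ≤ 1 := LinearMap.mkContinuous_norm_le _ zero_le_one _
  refine (ContinuousLinearMap.le_opNorm _ f).trans ?_
  rw [LinearIsometryEquiv.norm_map]
  exact mul_le_of_le_one_left (norm_nonneg _) h

theorem norm_expVec {α : Type*} [MeasurableSpace α] {μ : Measure α} [SigmaFinite μ]
    (f : Lp ℂ 2 μ) : ‖expVec f‖ = Real.sqrt (Real.exp (‖f‖ ^ 2)) := by
  rw [norm_eq_sqrt_re_inner (𝕜 := ℂ), inner_expVec, inner_self_eq_norm_sq_to_K]
  congr 1
  norm_cast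

/-- The integral kernel `x ↦ conj f(x) g(x)` of the inner product of `L²(ℝ₊)`, extended by zero
to the negative half-axis. -/
def innerKernel (f g : L2Half) : ℝ → ℂ := (Ici (0 : ℝ)).indicator fun x => ⟪f x, g x⟫_ℂ

theorem integrable_innerKernel (f g : L2Half) : Integrable (innerKernel f g) :=
  (integrable_indicator_iff measurableSet_Ici).2 (L2.integrable_inner f g)

theorem integral_Ioi_innerKernel (t : ℝ≥0) (f g : L2Half) :
    ∫ x in Ioi (t : ℝ), innerKernel f g x = ⟪ContinuousLinearMap.adjoint (shift t) f,
      ContinuousLinearMap.adjoint (shift t) g⟫_ℂ := by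
  rw [inner_adjoint_shift]
  refine setIntegral_congr_fun measurableSet_Ioi fun x hx => ?_
  exact indicator_of_mem (show (0 : ℝ) ≤ x from t.2.trans (le_of_lt hx)) _

theorem integral_Ioi_zero_innerKernel (f g : L2Half) :
    ∫ x in Ioi (0 : ℝ), innerKernel f g x = ⟪f, g⟫_ℂ := by
  simpa [adjoint_shift_zero] using integral_Ioi_innerKernel 0 f g

theorem continuous_expVec_adjoint_shift (f : L2Half) :
    Continuous fun s : ℝ => expVec (ContinuousLinearMap.adjoint (shift s.toNNReal) f) :=
  continuous_expVec.comp ((continuous_adjoint_shift f).comp continuous_real_toNNReal)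

theorem memLp_annihilated (f : L2Half) :
    MemLp (fun s : ℝ => f s • expVec (ContinuousLinearMap.adjoint (shift s.toNNReal) f)) 2
      halfLine := by
  refine (Lp.memLp f).of_le_mul (c := Real.sqrt (Real.exp (‖f‖ ^ 2))) ?_ ?_
  · exact (Lp.aestronglyMeasurable f).smul
      (continuous_expVec_adjoint_shift f).aestronglyMeasurable
  · refine Eventually.of_forall fun s => ?_
    rw [norm_smul, mul_comm, norm_expVec]
    gcongr
    exact norm_adjoint_shift_le _ f

/-- The function `s ↦ f(s) e(S_s^* f)` in `L²(ℝ₊; H)`. -/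
def annihilated (f : L2Half) : HL2 := (memLp_annihilated f).toLp _

theorem coeFn_annihilated (f : L2Half) : annihilated f =ᵐ[halfLine]
    fun s : ℝ => f s • expVec (ContinuousLinearMap.adjoint (shift s.toNNReal) f) :=
  (memLp_annihilated f).coeFn_toLp

theorem inner_annihilated (f g : L2Half) :
    ⟪annihilated f, annihilated g⟫_ℂ = Complex.exp ⟪f, g⟫_ℂ - 1 := by
  have h := integral_Ioi_mul_exp_tail (integrable_innerKernel f g)
  rw [integral_Ioi_zero_innerKernel] at h
  rw [← h, L2.inner_def, ← integral_Ici_eq_integral_Ioi]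
  refine integral_congr_ae ?_
  filter_upwards [coeFn_annihilated f, coeFn_annihilated g, ae_restrict_mem measurableSet_Ici]
    with s h1 h2 h3
  have h4 := integral_Ioi_innerKernel s.toNNReal f g
  rw [Real.coe_toNNReal s h3] at h4
  rw [h1, h2, h4, inner_smul_left, inner_smul_right, inner_expVec, innerKernel,
    indicator_of_mem h3, RCLike.inner_apply]
  ring

/-- The vector `Ω ⊕ ∫ e(S_s^* f) ⊗ χ(ds) f` of `H^`. -/
def hatVec (f : L2Half) : HHat := WithLp.toLp 2 (1, annihilated f)

theorem inner_hatVec (f g : L2Half) : ⟪hatVec f, hatVec g⟫_ℂ = ⟪expVec f, expVec g⟫_ℂ := by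
  rw [WithLp.prod_inner_apply, inner_expVec]
  change ⟪(1 : ℂ), 1⟫_ℂ + ⟪annihilated f, annihilated g⟫_ℂ = _
  rw [inner_annihilated]
  simp

theorem isW_iff (W : H ≃ₗᵢ[ℂ] HHat) : IsW W ↔ ∀ f, W (expVec f) = hatVec f := by
  refine ⟨fun h f => ?_, fun h f => ?_⟩
  · refine WithLp.ofLp_injective 2 (Prod.ext (h f).1 (Lp.ext ?_))
    exact (h f).2.trans (coeFn_annihilated f).symm
  · rw [h f]
    exact ⟨rfl, coeFn_annihilated f⟩

/-- If `v` is orthogonal to all functions `s ↦ f(s) e(S_s^* f)`, then already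
`f(s) ⟪v(s), e(S_s^* f)⟫ = 0` for almost every `s`: replacing `f` by its restriction to `(a, ∞)`
restricts the integral of this function to `(a, ∞)`. -/
theorem ae_inner_eq_zero_of_orthogonal {v : HL2} (hv : ∀ f, ⟪v, annihilated f⟫_ℂ = 0) (f : L2Half) :
    ∀ᵐ s ∂halfLine,
      f s * ⟪v s, expVec (ContinuousLinearMap.adjoint (shift s.toNNReal) f)⟫_ℂ = 0 := by
  let k : ℝ → ℂ := (Ici (0 : ℝ)).indicator fun s => ⟪v s, annihilated f s⟫_ℂ
  have hk : Integrable k :=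
    (integrable_indicator_iff measurableSet_Ici).2 (L2.integrable_inner v (annihilated f))
  have h0 : ∀ a : ℝ, 0 ≤ a → ∫ x in Ioi a, k x = 0 := by
    intro a ha
    lift a to ℝ≥0 using ha
    let g := shift a (ContinuousLinearMap.adjoint (shift a) f)
    have hg : annihilated g =ᵐ[halfLine] (Ioi (a : ℝ)).indicator (annihilated f) := by
      filter_upwards [coeFn_annihilated g, coeFn_annihilated f, coeFn_shift_adjoint_shift a f,
        ae_restrict_mem measurableSet_Ici] with s h1 h2 h3 hs
      rw [h1, show g s = (Ioi (a : ℝ)).indicator f s from h3]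
      by_cases hsa : (a : ℝ) < s
      · rw [indicator_of_mem (mem_Ioi.2 hsa), indicator_of_mem (mem_Ioi.2 hsa), h2]
        congr 2
        refine adjoint_shift_congr _ ?_
        filter_upwards [coeFn_shift_adjoint_shift a f] with x hx hxs
        rw [show g x = (Ioi (a : ℝ)).indicator f x from hx]
        rw [Real.coe_toNNReal s hs] at hxs
        exact indicator_of_mem (mem_Ioi.2 (hsa.trans hxs)) _
      · rw [indicator_of_notMem (by simpa using hsa), indicator_of_notMem (by simpa using hsa),
          zero_smul]
    rw [← hv g, L2.inner_def, ← halfLine_restrict_Ioi, ← integral_indicator measurableSet_Ioi]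
    refine integral_congr_ae ?_
    filter_upwards [hg, ae_restrict_mem measurableSet_Ici] with s hs h3
    rw [hs]
    by_cases hsa : (a : ℝ) < s
    · rw [indicator_of_mem (mem_Ioi.2 hsa), indicator_of_mem (mem_Ioi.2 hsa)]
      exact indicator_of_mem h3 _
    · rw [indicator_of_notMem (by simpa using hsa), indicator_of_notMem (by simpa using hsa),
        inner_zero_right]
  filter_upwards [ae_eq_zero_of_forall_integral_Ioi hk h0, coeFn_annihilated f,
    ae_restrict_mem measurableSet_Ici] with s h1 h2 h3
  rw [← inner_smul_right, ← h2, ← h1]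
  exact (indicator_of_mem h3 (fun s => ⟪v s, annihilated f s⟫_ℂ)).symm

theorem eq_zero_of_inner_annihilated {v : HL2} (hv : ∀ f, ⟪v, annihilated f⟫_ℂ = 0) : v = 0 := by
  have : Fact ((2 : ℝ≥0∞) ≠ ∞) := ⟨by norm_num⟩
  have hfin : ∀ q : ℝ, halfLine (Ico 0 q) ≠ ∞ := fun q =>
    ((Measure.restrict_apply_le _ _).trans_lt (by simp)).ne
  let χ : ℝ → L2Half := fun q => indicatorConstLp 2 measurableSet_Ico (hfin q) (1 : ℂ)
  let d : ℕ → L2Half := TopologicalSpace.denseSeq L2Half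
  let c : ℕ → ℂ := fun n => 1 / ((n : ℂ) + 1)
  -- Test vectors `S_q h + c χ_[0,q)`: they do not vanish on `[0, q)`, and for `s < q` the vector
  -- `S_s^* (S_q h + c χ_[0,q))` is close to `S_{q-s} h`, hence close to `h`.
  let w : ℚ → ℕ → ℕ → L2Half := fun q i n => shift (q : ℝ).toNNReal (d i) + c n • χ q
  rw [Lp.eq_zero_iff_ae_eq_zero]
  have h1 := ae_all_iff.2 fun q : ℚ => ae_all_iff.2 fun i : ℕ => ae_all_iff.2 fun n : ℕ =>
    ae_inner_eq_zero_of_orthogonal hv (w q i n)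
  have h2 : ∀ᵐ s : ℝ ∂halfLine, ∀ q : ℚ, ∀ i n : ℕ, s < q → w q i n s ≠ 0 := by
    refine ae_all_iff.2 fun q => ae_all_iff.2 fun i => ae_all_iff.2 fun n => ?_
    have hχ : χ q =ᵐ[halfLine] (Ico (0 : ℝ) q).indicator fun _ => 1 := indicatorConstLp_coeFn
    filter_upwards [Lp.coeFn_add (shift (q : ℝ).toNNReal (d i)) (c n • χ q),
      Lp.coeFn_smul (c n) (χ q), coeFn_shift (q : ℝ).toNNReal (d i),
      hχ, ae_restrict_mem measurableSet_Ici] with s h3 h4 h5 h6 h7 hsq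
    have h8 : ¬ (((q : ℝ).toNNReal : ℝ) < s) := by
      rw [Real.coe_toNNReal _ ((show (0 : ℝ) ≤ s from h7).trans hsq.le)]
      exact not_lt.2 hsq.le
    have h9 : w q i n s = c n := by
      rw [h3, Pi.add_apply, h4, h5, if_neg h8, zero_add, Pi.smul_apply,
        h6, indicator_of_mem (show s ∈ Ico (0 : ℝ) q from ⟨h7, hsq⟩)]
      simp
    rw [h9]
    exact one_div_ne_zero (Nat.cast_add_one_ne_zero n)
  filter_upwards [h1, h2, ae_restrict_mem measurableSet_Ici] with s h3 h4 hs
  have hs0 : (0 : ℝ) ≤ s := hs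
  have h5 : ∀ (q : ℚ) (i : ℕ), s < q →
      ⟪v s, expVec (shift ((q : ℝ) - s).toNNReal (d i))⟫_ℂ = 0 := by
    intro q i hsq
    have h6 : ∀ n, ⟪v s, expVec (ContinuousLinearMap.adjoint (shift s.toNNReal)
        (shift (q : ℝ).toNNReal (d i) + c n • χ q))⟫_ℂ = 0 := fun n =>
      (mul_eq_zero.1 (h3 q i n)).resolve_left (h4 q i n hsq)
    have h7 : Tendsto (fun n => ⟪v s, expVec (ContinuousLinearMap.adjoint (shift s.toNNReal)
        (shift (q : ℝ).toNNReal (d i) + c n • χ q))⟫_ℂ) atTop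
        (𝓝 ⟪v s, expVec (ContinuousLinearMap.adjoint (shift s.toNNReal)
        (shift (q : ℝ).toNNReal (d i) + (0 : ℂ) • χ q))⟫_ℂ) := by
      have h8 : Continuous fun z : ℂ => ⟪v s, expVec (ContinuousLinearMap.adjoint
          (shift s.toNNReal) (shift (q : ℝ).toNNReal (d i) + z • χ q))⟫_ℂ := by
        have := continuous_expVec (μ := halfLine)
        fun_prop
      exact (h8.tendsto 0).comp (tendsto_one_div_add_atTop_nhds_zero_nat (𝕜 := ℂ))
    have h8 := tendsto_nhds_unique h7 (tendsto_const_nhds.congr fun n => (h6 n).symm)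
    have h9 : (q : ℝ).toNNReal = s.toNNReal + ((q : ℝ) - s).toNNReal := by
      rw [← Real.toNNReal_add hs0 (sub_nonneg.2 hsq.le), add_sub_cancel]
    rwa [zero_smul, add_zero, h9, ← shift_shift, adjoint_shift_shift] at h8
  have h6 : ∀ i, ⟪v s, expVec (d i)⟫_ℂ = 0 := by
    intro i
    by_contra hne
    have h7 : Tendsto (fun r : ℝ≥0 => ⟪v s, expVec (shift r (d i))⟫_ℂ) (𝓝 0)
        (𝓝 ⟪v s, expVec (d i)⟫_ℂ) :=
      tendsto_const_nhds.inner ((continuous_expVec.tendsto _).comp (tendsto_shift_zero (d i)))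
    have h8 : Tendsto (fun x : ℝ => (x - s).toNNReal) (𝓝 s) (𝓝 0) := by
      have h9 : Continuous fun x : ℝ => (x - s).toNNReal := by fun_prop
      simpa using h9.tendsto s
    have h9 := (h7.comp h8).eventually_ne hne
    obtain ⟨ε, hε, hball⟩ := Metric.eventually_nhds_iff.1 h9
    obtain ⟨q, hq1, hq2⟩ := exists_rat_btwn (lt_add_of_pos_right s hε)
    refine hball (y := (q : ℝ)) ?_ (h5 q i hq1)
    rw [Real.dist_eq, abs_lt]
    constructor <;> linarith
  refine eq_zero_of_inner_expVec _ fun h => ?_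
  refine (TopologicalSpace.denseRange_denseSeq L2Half).induction_on
    (p := fun h => ⟪v s, expVec h⟫_ℂ = 0) h ?_ h6
  exact isClosed_eq (continuous_const.inner continuous_expVec) continuous_const

theorem eq_zero_of_inner_hatVec (x : HHat) (h : ∀ f, ⟪x, hatVec f⟫_ℂ = 0) : x = 0 := by
  have h1 : ∀ f, ⟪x.fst, (1 : ℂ)⟫_ℂ + ⟪x.snd, annihilated f⟫_ℂ = 0 := fun f => by
    rw [← h f, WithLp.prod_inner_apply]; rfl
  have h2 : annihilated 0 = 0 := by
    refine Lp.ext ?_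
    filter_upwards [coeFn_annihilated 0, Lp.coeFn_zero ℂ 2 halfLine, Lp.coeFn_zero H 2 halfLine]
      with s h3 h4 h5
    rw [h3, h4, h5, Pi.zero_apply, Pi.zero_apply, zero_smul]
  have h3 : ⟪x.fst, (1 : ℂ)⟫_ℂ = 0 := by simpa [h2] using h1 0
  have h4 : x.snd = 0 := eq_zero_of_inner_annihilated fun f => by
    have h5 := h1 f
    rwa [h3, zero_add] at h5
  have h5 : x.fst = 0 := by simpa using h3
  exact WithLp.ofLp_injective 2 (Prod.ext h5 h4)

theorem existsUnique_isW : ∃! W : H ≃ₗᵢ[ℂ] HHat, IsW W := by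
  obtain ⟨W, hW⟩ := exists_linearIsometryEquiv_of_inner_eq dense_span_expVec
    (dense_span_of_forall_inner eq_zero_of_inner_hatVec) inner_hatVec
  refine ⟨W, (isW_iff W).2 hW, fun V hV => ?_⟩
  replace hV := (isW_iff V).1 hV
  have h : (V : H →L[ℂ] HHat) = W := op_ext_expVec fun f => (hV f).trans (hW f).symm
  exact LinearIsometryEquiv.ext fun x => DFunLike.congr_fun h x

end UnitaryW

/-! ### The factorization of the Fock space at time `t` -/

section Factorization

theorem coeFn_extendZero (t : ℝ≥0) (f : Lp ℂ 2 (volume.restrict (Ioo (0 : ℝ) t))) :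
    extendZero t f =ᵐ[halfLine] (Ioo (0 : ℝ) t).indicator f :=
  MemLp.coeFn_toLp _

theorem inner_extendZero (t : ℝ≥0) (f g : Lp ℂ 2 (volume.restrict (Ioo (0 : ℝ) t))) :
    ⟪extendZero t f, extendZero t g⟫_ℂ = ⟪f, g⟫_ℂ := by
  have h1 : ∫ x, ⟪extendZero t f x, extendZero t g x⟫_ℂ ∂halfLine
      = ∫ x, (Ioo (0 : ℝ) t).indicator (fun x => ⟪f x, g x⟫_ℂ) x ∂halfLine := by
    refine integral_congr_ae ?_
    filter_upwards [coeFn_extendZero t f, coeFn_extendZero t g] with x h1 h2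
    rw [h1, h2]
    by_cases hx : x ∈ Ioo (0 : ℝ) t <;> simp [hx]
  rw [L2.inner_def, L2.inner_def, h1, integral_indicator measurableSet_Ioo,
    Measure.restrict_restrict measurableSet_Ioo,
    inter_eq_left.2 (Ioo_subset_Ioi_self.trans Ioi_subset_Ici_self)]

theorem inner_extendZero_shift (t : ℝ≥0) (f : Lp ℂ 2 (volume.restrict (Ioo (0 : ℝ) t)))
    (g : L2Half) : ⟪extendZero t f, shift t g⟫_ℂ = 0 := by
  rw [L2.inner_def]
  refine integral_eq_zero_of_ae ?_
  filter_upwards [coeFn_extendZero t f, coeFn_shift t g] with x h1 h2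
  rw [h1, h2]
  by_cases hx : (t : ℝ) < x
  · have : x ∉ Ioo (0 : ℝ) t := fun h => lt_asymm hx h.2
    simp [this]
  · simp [hx]

theorem inner_extendZero_add_shift (t : ℝ≥0)
    (f f' : Lp ℂ 2 (volume.restrict (Ioo (0 : ℝ) t))) (g g' : L2Half) :
    ⟪extendZero t f + shift t g, extendZero t f' + shift t g'⟫_ℂ = ⟪f, f'⟫_ℂ + ⟪g, g'⟫_ℂ := by
  have h : ⟪shift t g, extendZero t f'⟫_ℂ = 0 := by
    rw [← inner_conj_symm, inner_extendZero_shift, map_zero]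
  rw [inner_add_left, inner_add_right, inner_add_right, inner_extendZero, inner_shift,
    inner_extendZero_shift, h]
  ring

/-- The restriction of `f ∈ L²(ℝ₊)` to `(0, t)`. -/
def initialPart (t : ℝ≥0) (f : L2Half) : Lp ℂ 2 (volume.restrict (Ioo (0 : ℝ) t)) :=
  ((Lp.memLp f).mono_measure (Measure.restrict_mono
    (Ioo_subset_Ioi_self.trans Ioi_subset_Ici_self) le_rfl)).toLp f

theorem extendZero_initialPart_add (t : ℝ≥0) (f : L2Half) :
    extendZero t (initialPart t f) + shift t (ContinuousLinearMap.adjoint (shift t) f) = f := by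
  refine Lp.ext ?_
  have h1 : ∀ᵐ x ∂halfLine, x ∈ Ioo (0 : ℝ) t → initialPart t f x = f x := by
    have h := MemLp.coeFn_toLp ((Lp.memLp f).mono_measure (Measure.restrict_mono
      (Ioo_subset_Ioi_self.trans Ioi_subset_Ici_self : Ioo (0 : ℝ) t ⊆ Ici 0) le_rfl))
    exact ae_restrict_of_ae ((ae_restrict_iff' measurableSet_Ioo).1 h)
  have h2 : ∀ᵐ x ∂halfLine, x ∈ Ioi (0 : ℝ) := by
    rw [halfLine, ← restrict_Ioi_eq_restrict_Ici]
    exact ae_restrict_mem measurableSet_Ioi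
  have h3 : ∀ᵐ x : ℝ ∂halfLine, x ≠ t := ae_restrict_of_ae (Measure.ae_ne volume (t : ℝ))
  filter_upwards [Lp.coeFn_add (extendZero t (initialPart t f))
    (shift t (ContinuousLinearMap.adjoint (shift t) f)), coeFn_extendZero t (initialPart t f),
    coeFn_shift_adjoint_shift t f, h1, h2, h3] with x h4 h5 h6 h7 h8 h9
  rw [h4, Pi.add_apply, h5, h6]
  rcases lt_or_gt_of_ne h9 with hx | hx
  · have h10 : x ∈ Ioo (0 : ℝ) t := ⟨h8, hx⟩
    rw [indicator_of_mem h10, indicator_of_notMem (by simpa using hx.le), h7 h10, add_zero]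
  · rw [indicator_of_notMem fun h => lt_asymm hx h.2, indicator_of_mem (mem_Ioi.2 hx), zero_add]

theorem inner_eq_initialPart_add (t : ℝ≥0) (f g : L2Half) :
    ⟪f, g⟫_ℂ = ⟪initialPart t f, initialPart t g⟫_ℂ
      + ⟪ContinuousLinearMap.adjoint (shift t) f, ContinuousLinearMap.adjoint (shift t) g⟫_ℂ := by
  rw [← inner_extendZero_add_shift, extendZero_initialPart_add, extendZero_initialPart_add]

theorem dense_span_tmul_expVec (t : ℝ≥0) :
    Dense (Submodule.span ℂ (range fun p : Lp ℂ 2 (volume.restrict (Ioo (0 : ℝ) t)) × L2Half =>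
      (expVec p.1 ⊗ₜ[ℂ] expVec p.2 : FockInitial t ⊗[ℂ] H)) : Set (FockInitial t ⊗[ℂ] H)) := by
  set S := Submodule.span ℂ (range fun p : Lp ℂ 2 (volume.restrict (Ioo (0 : ℝ) t)) × L2Half =>
      (expVec p.1 ⊗ₜ[ℂ] expVec p.2 : FockInitial t ⊗[ℂ] H)) with hS
  rw [Submodule.dense_iff_topologicalClosure_eq_top, eq_top_iff]
  have hcl : IsClosed (S.topologicalClosure : Set (FockInitial t ⊗[ℂ] H)) :=
    S.isClosed_topologicalClosure
  have h1 : ∀ f (b : H), (expVec f ⊗ₜ[ℂ] b : FockInitial t ⊗[ℂ] H) ∈ S.topologicalClosure := by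
    intro f b
    refine (dense_span_expVec (μ := halfLine)).induction ?_ ?_ b
    · intro b hb
      induction hb using Submodule.span_induction with
      | mem x hx =>
        obtain ⟨g, rfl⟩ := hx
        exact S.le_topologicalClosure (Submodule.subset_span ⟨(f, g), rfl⟩)
      | zero => rw [TensorProduct.tmul_zero]; exact zero_mem _
      | add x y _ _ hx hy => rw [TensorProduct.tmul_add]; exact add_mem hx hy
      | smul c x _ hx => rw [TensorProduct.tmul_smul]; exact Submodule.smul_mem _ c hx
    · exact hcl.preimage (TensorProduct.continuous_tmul.comp (Continuous.prodMk_right _))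
  have h2 : ∀ (a : FockInitial t) (b : H), a ⊗ₜ[ℂ] b ∈ S.topologicalClosure := by
    intro a b
    refine (dense_span_expVec (μ := volume.restrict (Ioo (0 : ℝ) t))).induction ?_ ?_ a
    · intro a ha
      induction ha using Submodule.span_induction with
      | mem x hx =>
        obtain ⟨f, rfl⟩ := hx
        exact h1 f b
      | zero => rw [TensorProduct.zero_tmul]; exact zero_mem _
      | add x y _ _ hx hy => rw [TensorProduct.add_tmul]; exact add_mem hx hy
      | smul c x _ hx => rw [← TensorProduct.smul_tmul']; exact Submodule.smul_mem _ c hx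
    · exact hcl.preimage (TensorProduct.continuous_tmul.comp (Continuous.prodMk_left _))
  intro x _
  induction x using TensorProduct.induction_on with
  | zero => exact zero_mem _
  | tmul a b => exact h2 a b
  | add x y hx hy => exact add_mem (hx trivial) (hy trivial)

theorem exists_isFactorization (t : ℝ≥0) :
    ∃ U : (FockInitial t ⊗[ℂ] H) →ₗᵢ[ℂ] H, IsFactorization t U := by
  obtain ⟨U, hU⟩ := exists_linearIsometry_of_inner_eq (dense_span_tmul_expVec t)
    (b := fun p => expVec (extendZero t p.1 + shift t p.2)) (by
      rintro ⟨f, g⟩ ⟨f', g'⟩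
      simp only [TensorProduct.inner_tmul, inner_expVec, inner_extendZero_add_shift,
        Complex.exp_add])
  refine ⟨U, ?_, fun f g => hU (f, g)⟩
  have h1 : range (expVec : L2Half → H) ⊆ LinearMap.range U.toLinearMap := by
    rintro _ ⟨f, rfl⟩
    refine ⟨expVec (initialPart t f) ⊗ₜ[ℂ] expVec (ContinuousLinearMap.adjoint (shift t) f), ?_⟩
    have h2 := hU (initialPart t f, ContinuousLinearMap.adjoint (shift t) f)
    rwa [extendZero_initialPart_add] at h2
  have h2 : (Submodule.span ℂ (range (expVec : L2Half → H)) : Set H) ⊆ range U :=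
    Submodule.span_le.2 h1
  exact dense_span_expVec.mono h2

theorem isFactorization_unique {t : ℝ≥0} {U V : (FockInitial t ⊗[ℂ] H) →ₗᵢ[ℂ] H}
    (hU : IsFactorization t U) (hV : IsFactorization t V) : U = V := by
  have h : U.toContinuousLinearMap = V.toContinuousLinearMap :=
    ContinuousLinearMap.ext_on (dense_span_tmul_expVec t) (by
      rintro _ ⟨⟨f, g⟩, rfl⟩
      exact (hU.2 f g).trans (hV.2 f g).symm)
  exact LinearIsometry.ext fun x => DFunLike.congr_fun h x

theorem IsFactorization.expVec_eq {t : ℝ≥0} {U : (FockInitial t ⊗[ℂ] H) →ₗᵢ[ℂ] H}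
    (hU : IsFactorization t U) (f : L2Half) :
    U (expVec (initialPart t f) ⊗ₜ[ℂ] expVec (ContinuousLinearMap.adjoint (shift t) f))
      = expVec f := by
  rw [hU.2, extendZero_initialPart_add]

theorem isForgetting_comp {t : ℝ≥0} {X Z : Op H} {U : (FockInitial t ⊗[ℂ] H) →ₗᵢ[ℂ] H}
    (hZ : ∀ (a : FockInitial t) (b : H), Z (U (a ⊗ₜ[ℂ] b)) = U (a ⊗ₜ[ℂ] X b))
    (x : FockInitial t ⊗[ℂ] H) : Z (U x) = U (X.lTensor (FockInitial t) x) := by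
  induction x using TensorProduct.induction_on with
  | zero => simp
  | tmul a b => exact hZ a b
  | add x y hx hy => simp only [map_add, hx, hy]

theorem existsUnique_isForgetting (t : ℝ≥0) (X : Op H) : ∃! Z : Op H, IsForgetting t X Z := by
  obtain ⟨U, hU⟩ := exists_isFactorization t
  let A : (FockInitial t ⊗[ℂ] H) →ₗ[ℂ] H :=
    U.toLinearMap ∘ₗ (X.lTensor (FockInitial t)).toLinearMap
  have hA : ∀ x, ‖A x‖ ≤ ‖X‖ * ‖U.toLinearMap x‖ := by
    intro x
    change ‖U (X.lTensor (FockInitial t) x)‖ ≤ ‖X‖ * ‖U x‖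
    rw [U.norm_map, U.norm_map]
    exact ContinuousLinearMap.le_of_opNorm_le _ (ContinuousLinearMap.norm_lTensor_le _ X) x
  refine ⟨A.extendOfNorm U.toLinearMap, ⟨U, hU, fun a b => ?_⟩, fun Z hZ => ?_⟩
  · exact LinearMap.extendOfNorm_eq hU.1 ⟨‖X‖, hA⟩ (a ⊗ₜ[ℂ] b)
  · obtain ⟨V, hV, hZV⟩ := hZ
    obtain rfl := isFactorization_unique hU hV
    refine (LinearMap.extendOfNorm_unique hU.1 ‖X‖ hA Z ?_).symm
    exact LinearMap.ext fun x => isForgetting_comp hZV x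

theorem IsForgetting.norm_le {t : ℝ≥0} {X Z : Op H} (h : IsForgetting t X Z) : ‖Z‖ ≤ ‖X‖ := by
  obtain ⟨U, hU, hZ⟩ := h
  refine Z.opNorm_le_bound (norm_nonneg _) fun y => ?_
  refine hU.1.induction_on (p := fun y => ‖Z y‖ ≤ ‖X‖ * ‖y‖) y
    (isClosed_le (by fun_prop) (by fun_prop)) fun x => ?_
  rw [isForgetting_comp hZ, U.norm_map, U.norm_map]
  exact ContinuousLinearMap.le_of_opNorm_le _ (ContinuousLinearMap.norm_lTensor_le _ X) x

/-- Matrix elements of `I ⊗ X` between exponential vectors. -/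
theorem IsForgetting.inner_expVec {t : ℝ≥0} {X Z : Op H} (h : IsForgetting t X Z)
    (f g : L2Half) :
    ⟪expVec f, Z (expVec g)⟫_ℂ = Complex.exp (⟪f, g⟫_ℂ
        - ⟪ContinuousLinearMap.adjoint (shift t) f, ContinuousLinearMap.adjoint (shift t) g⟫_ℂ)
      * ⟪expVec (ContinuousLinearMap.adjoint (shift t) f),
          X (expVec (ContinuousLinearMap.adjoint (shift t) g))⟫_ℂ := by
  obtain ⟨U, hU, hZ⟩ := h
  rw [← hU.expVec_eq f, ← hU.expVec_eq g, hZ, U.inner_map_map, TensorProduct.inner_tmul,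
    FockShift.inner_expVec, inner_eq_initialPart_add t f g, add_sub_cancel_right]

end Factorization

/-! ### The second quantized shifts -/

section FockShiftOperators

theorem existsUnique_isFockShift (t : ℝ≥0) : ∃! T : Op H, IsFockShift t T := by
  obtain ⟨V, hV⟩ := exists_linearIsometry_of_inner_eq dense_span_expVec
    (b := fun f : L2Half => expVec (shift t f))
    (fun f g => by simp only [inner_expVec, inner_shift])
  exact ⟨V.toContinuousLinearMap, hV, fun T hT => op_ext_expVec fun f => (hT f).trans (hV f).symm⟩

theorem IsFockShift.adjoint_expVec {t : ℝ≥0} {T : Op H} (hT : IsFockShift t T) (f : L2Half) :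
    ContinuousLinearMap.adjoint T (expVec f)
      = expVec (ContinuousLinearMap.adjoint (shift t) f) := by
  refine ext_inner_expVec fun g => ?_
  rw [ContinuousLinearMap.adjoint_inner_right, hT, inner_expVec, inner_expVec,
    ContinuousLinearMap.adjoint_inner_right]

theorem inner_noEvent_expVec {T : ℝ≥0 → Op H} {t : ℝ≥0} (hT : IsFockShift t (T t)) (X : Op H)
    (f g : L2Half) :
    ⟪expVec f, noEvent T t X (expVec g)⟫_ℂ
      = ⟪expVec (ContinuousLinearMap.adjoint (shift t) f),
          X (expVec (ContinuousLinearMap.adjoint (shift t) g))⟫_ℂ := by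
  simp only [noEvent, ContinuousLinearMap.comp_apply]
  rw [← ContinuousLinearMap.adjoint_inner_left, hT.adjoint_expVec, hT.adjoint_expVec]

end FockShiftOperators

/-! ### Convergence of bounded families in the `w*`-topology -/

section WeakConvergence

variable {ι κ K : Type*} [NormedAddCommGroup K] [InnerProductSpace ℂ K]

theorem tendsto_zero_of_dense_span {l : Filter ι} {L : ι → K →L[ℂ] ℂ} {C : ℝ}
    (hL : ∀ i, ‖L i‖ ≤ C) {a : κ → K} (ha : Dense (Submodule.span ℂ (range a) : Set K))
    (h : ∀ j, Tendsto (fun i => L i (a j)) l (𝓝 0)) (x : K) :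
    Tendsto (fun i => L i x) l (𝓝 0) := by
  have hspan : ∀ z ∈ Submodule.span ℂ (range a), Tendsto (fun i => L i z) l (𝓝 0) := by
    intro z hz
    induction hz using Submodule.span_induction with
    | mem z hz =>
      obtain ⟨j, rfl⟩ := hz
      exact h j
    | zero => simpa using tendsto_const_nhds
    | add x y _ _ hx hy => simpa using hx.add hy
    | smul c x _ hx => simpa using hx.const_mul c
  rw [Metric.tendsto_nhds]
  intro ε hε
  have hpos : 0 < |C| + 1 := by positivity
  obtain ⟨z, hz, hxz⟩ := Metric.dense_iff.1 ha x (ε / (2 * (|C| + 1))) (by positivity)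
  filter_upwards [Metric.tendsto_nhds.1 (hspan z hxz) (ε / 2) (by positivity)] with i hi
  rw [dist_zero_right] at hi ⊢
  have h1 : ‖L i (x - z)‖ ≤ ε / 2 := by
    refine ((L i).le_opNorm _).trans ?_
    rw [← dist_eq_norm, dist_comm]
    calc ‖L i‖ * dist z x ≤ (|C| + 1) * (ε / (2 * (|C| + 1))) := by
          gcongr
          · exact (hL i).trans ((le_abs_self C).trans (by linarith))
          · exact (Metric.mem_ball.1 hz).le
      _ = ε / 2 := by field_simp
  calc ‖L i x‖ = ‖L i (x - z) + L i z‖ := by rw [← map_add, sub_add_cancel]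
    _ ≤ ‖L i (x - z)‖ + ‖L i z‖ := norm_add_le _ _
    _ < ε := by linarith

/-- A bounded family of operators whose matrix elements between the vectors of a total family tend
to zero tends to zero in the `w*`-topology. -/
theorem tendsto_tsum_inner_of_dense_span {l : Filter ι} {B : ι → Op K} {C : ℝ}
    (hB : ∀ i, ‖B i‖ ≤ C) {a : κ → K} (ha : Dense (Submodule.span ℂ (range a) : Set K))
    (h : ∀ j k, Tendsto (fun i => ⟪a j, B i (a k)⟫_ℂ) l (𝓝 0)) {ξ η : ℕ → K}
    (hξ : Summable fun k => ‖ξ k‖ ^ 2) (hη : Summable fun k => ‖η k‖ ^ 2) :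
    Tendsto (fun i => ∑' k, ⟪ξ k, B i (η k)⟫_ℂ) l (𝓝 0) := by
  have h1 : ∀ j y, Tendsto (fun i => ⟪a j, B i y⟫_ℂ) l (𝓝 0) := by
    intro j y
    refine tendsto_zero_of_dense_span (L := fun i => innerSL ℂ (a j) ∘L B i)
      (C := ‖a j‖ * C) (fun i => ?_) ha (h j) y
    refine (ContinuousLinearMap.opNorm_comp_le _ _).trans ?_
    rw [innerSL_apply_norm]
    gcongr
    exact hB i
  have h2 : ∀ x y, Tendsto (fun i => ⟪B i y, x⟫_ℂ) l (𝓝 0) := by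
    intro x y
    refine tendsto_zero_of_dense_span (L := fun i => innerSL ℂ (B i y))
      (C := C * ‖y‖) (fun i => ?_) ha (fun j => ?_) x
    · rw [innerSL_apply_norm]
      exact (B i).le_of_opNorm_le (hB i) y
    · have h3 := (Complex.continuous_conj.tendsto 0).comp (h1 j y)
      rw [map_zero] at h3
      refine h3.congr fun i => ?_
      exact inner_conj_symm _ _
  have h3 : ∀ x y, Tendsto (fun i => ⟪x, B i y⟫_ℂ) l (𝓝 0) := by
    intro x y
    have h3 := (Complex.continuous_conj.tendsto 0).comp (h2 x y)
    rw [map_zero] at h3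
    exact h3.congr fun i => inner_conj_symm _ _
  have hsum : Summable fun k => |C| * (‖ξ k‖ ^ 2 + ‖η k‖ ^ 2) := (hξ.add hη).mul_left _
  have h4 := tendsto_tsum_of_dominated_convergence (f := fun i k => ⟪ξ k, B i (η k)⟫_ℂ) (𝓕 := l)
    hsum (fun k => h3 (ξ k) (η k)) (Eventually.of_forall fun i k => by
      have h5 : ‖B i (η k)‖ ≤ |C| * ‖η k‖ :=
        (B i).le_of_opNorm_le ((hB i).trans (le_abs_self C)) _
      calc ‖⟪ξ k, B i (η k)⟫_ℂ‖ ≤ ‖ξ k‖ * ‖B i (η k)‖ := norm_inner_le_norm _ _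
        _ ≤ ‖ξ k‖ * (|C| * ‖η k‖) := by gcongr
        _ = |C| * (‖ξ k‖ * ‖η k‖) := by ring
        _ ≤ |C| * (‖ξ k‖ ^ 2 + ‖η k‖ ^ 2) := by
          gcongr
          nlinarith [sq_nonneg (‖ξ k‖ - ‖η k‖), sq_nonneg (‖ξ k‖), sq_nonneg (‖η k‖)])
  simpa using h4

end WeakConvergence

/-! ### Riemann sums -/

section RiemannSums

namespace TaggedPartition

variable {t : ℝ≥0} (P : TaggedPartition t)

theorem point_le_succ {i : ℕ} (hi : i < P.n) : P.point i ≤ P.point (i + 1) :=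
  (P.tag_mem i hi).1.trans (P.tag_mem i hi).2

theorem point_le_last {i : ℕ} (hi : i ≤ P.n) : P.point i ≤ t := by
  induction hi using Nat.decreasingInduction with
  | self => exact P.point_last.le
  | of_succ k hk ih => exact (P.point_le_succ hk).trans ih

theorem tag_le {i : ℕ} (hi : i < P.n) : P.tag i ≤ t :=
  (P.tag_mem i hi).2.trans (P.point_le_last hi)

/-- The mesh of a partition, a supremum in `ℝ≥0` and thus `0` for `n = 0`. The subtraction is not
truncated, since the points increase. -/
def mesh : ℝ≥0 := (Finset.range P.n).sup fun i => P.point (i + 1) - P.point i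

theorem mesh_lt_iff {δ : ℝ≥0} (hδ : 0 < δ) :
    P.mesh < δ ↔ ∀ i < P.n, (P.point (i + 1) : ℝ) - P.point i < δ := by
  rw [mesh, Finset.sup_lt_iff (by simpa using hδ)]
  simp only [Finset.mem_range]
  refine forall₂_congr fun i hi => ?_
  rw [← NNReal.coe_lt_coe, NNReal.coe_sub (P.point_le_succ hi)]

/-- The filter of tagged partitions whose mesh tends to zero. -/
def meshFilter (t : ℝ≥0) : Filter (TaggedPartition t) := comap mesh (𝓝 0)

theorem hasBasis_meshFilter (t : ℝ≥0) :
    (meshFilter t).HasBasis (fun δ : ℝ≥0 => 0 < δ) fun δ => {P | P.mesh < δ} :=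
  NNReal.nhds_zero_basis.comap mesh

end TaggedPartition

open TaggedPartition

variable {K : Type*} [NormedAddCommGroup K] [InnerProductSpace ℂ K]

theorem hasIntegral_of_tendsto {M : OperatorMeasure K} {F : ℝ≥0 → Op K} {t : ℝ≥0} {A : Op K}
    (h : ∀ ξ η : ℕ → K, (Summable fun k => ‖ξ k‖ ^ 2) → (Summable fun k => ‖η k‖ ^ 2) →
      Tendsto (fun P : TaggedPartition t => ∑' k, ⟪ξ k, (riemannSum M F P - A) (η k)⟫_ℂ)
        (meshFilter t) (𝓝 0)) : HasIntegral M F t A := by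
  intro ξ η hξ hη ε hε
  obtain ⟨δ, hδ, hP⟩ := (hasBasis_meshFilter t).eventually_iff.1
    (Metric.tendsto_nhds.1 (h ξ η hξ hη) ε hε)
  refine ⟨δ, hδ, fun P hmesh => ?_⟩
  have h1 := hP ((P.mesh_lt_iff hδ).2 hmesh)
  rwa [dist_zero_right] at h1

theorem riemannSum_tensorMeasure_apply {E : Type*} [NormedAddCommGroup E] [InnerProductSpace ℂ E]
    (W : E ≃ₗᵢ[ℂ] WithLp 2 (ℂ × Lp E 2 halfLine)) (F : ℝ≥0 → Op E) {t : ℝ≥0}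
    (P : TaggedPartition t) (y : E) :
    riemannSum (tensorMeasure W) F P y = ∑ i ∈ Finset.range P.n,
      W.symm (WithLp.toLp 2 (0, tensorIndicator (F (P.tag i))
        (measurableSet_Ico (a := (P.point i : ℝ)) (b := P.point (i + 1))) (W y).snd)) := by
  rw [riemannSum, _root_.sum_apply]
  rfl

/-- For an increasing sequence of points, at most one of the functions `χ_{[pᵢ, pᵢ₊₁)}` is nonzero
at a given `s`. -/
theorem norm_sum_indicator_le {E : Type*} [NormedAddCommGroup E] {p : ℕ → ℝ} {y : ℕ → E} {C : ℝ}
    (hC : 0 ≤ C) {n : ℕ} (hp : ∀ i < n, p i ≤ p (i + 1)) (hy : ∀ i < n, ‖y i‖ ≤ C) (s : ℝ) :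
    ‖∑ i ∈ Finset.range n, (Ico (p i) (p (i + 1))).indicator (fun _ => y i) s‖ ≤ C := by
  have h : ∀ m ≤ n,
      ‖∑ i ∈ Finset.range m, (Ico (p i) (p (i + 1))).indicator (fun _ => y i) s‖ ≤ C ∧
      (p m ≤ s → ∑ i ∈ Finset.range m, (Ico (p i) (p (i + 1))).indicator (fun _ => y i) s = 0) := by
    intro m
    induction m with
    | zero => intro _; simp [hC]
    | succ m ih =>
      intro hm
      obtain ⟨ih1, ih2⟩ := ih (by omega)
      rw [Finset.sum_range_succ]
      by_cases hs : s ∈ Ico (p m) (p (m + 1))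
      · rw [indicator_of_mem hs, ih2 hs.1, zero_add]
        exact ⟨hy m hm, fun h => absurd hs.2 (not_lt.2 h)⟩
      · rw [indicator_of_notMem hs, add_zero]
        exact ⟨ih1, fun h => ih2 ((hp m hm).trans h)⟩
  exact (h n le_rfl).1

theorem norm_sum_tensorIndicator_le {E : Type*} [NormedAddCommGroup E] [InnerProductSpace ℂ E]
    {μ : Measure ℝ} {p : ℕ → ℝ} {Y : ℕ → Op E} {C : ℝ} (hC : 0 ≤ C) {n : ℕ}
    (hp : ∀ i < n, p i ≤ p (i + 1)) (hY : ∀ i < n, ‖Y i‖ ≤ C) (u : Lp E 2 μ) :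
    ‖∑ i ∈ Finset.range n, tensorIndicator (Y i)
      (measurableSet_Ico (a := p i) (b := p (i + 1))) u‖ ≤ C * ‖u‖ := by
  have h1 : ∀ m : ℕ, ∀ᵐ s ∂μ, (∑ i ∈ Finset.range m, tensorIndicator (Y i)
      (measurableSet_Ico (a := p i) (b := p (i + 1))) u : Lp E 2 μ) s
        = ∑ i ∈ Finset.range m, (Ico (p i) (p (i + 1))).indicator (fun _ => Y i (u s)) s := by
    intro m
    induction m with
    | zero =>
      filter_upwards [Lp.coeFn_zero E 2 μ] with s hs
      simpa using hs
    | succ m ih =>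
      filter_upwards [ih, coeFn_tensorIndicator (Y m)
        (measurableSet_Ico (a := p m) (b := p (m + 1))) u, Lp.coeFn_add
        (∑ i ∈ Finset.range m, tensorIndicator (Y i)
          (measurableSet_Ico (a := p i) (b := p (i + 1))) u : Lp E 2 μ)
        (tensorIndicator (Y m) (measurableSet_Ico (a := p m) (b := p (m + 1))) u)]
        with s h2 h3 h4
      rw [Finset.sum_range_succ, Finset.sum_range_succ, h4, Pi.add_apply, h2, h3]
      rfl
  refine Lp.norm_le_mul_norm_of_ae_le_mul ?_
  filter_upwards [h1 n] with s hs
  rw [hs]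
  refine norm_sum_indicator_le (by positivity) hp (fun i hi => ?_) s
  exact (Y i).le_of_opNorm_le (hY i hi) _

/-- The Riemann sums of an integrand bounded by `C` are bounded by `C`. -/
theorem norm_riemannSum_le {E : Type*} [NormedAddCommGroup E] [InnerProductSpace ℂ E]
    (W : E ≃ₗᵢ[ℂ] WithLp 2 (ℂ × Lp E 2 halfLine)) {F : ℝ≥0 → Op E} {C : ℝ} (hC : 0 ≤ C)
    (hF : ∀ s, ‖F s‖ ≤ C) {t : ℝ≥0} (P : TaggedPartition t) :
    ‖riemannSum (tensorMeasure W) F P‖ ≤ C := by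
  refine ContinuousLinearMap.opNorm_le_bound _ hC fun y => ?_
  have h1 : riemannSum (tensorMeasure W) F P y = W.symm (WithLp.toLp 2 (0,
      ∑ i ∈ Finset.range P.n, tensorIndicator (F (P.tag i))
        (measurableSet_Ico (a := (P.point i : ℝ)) (b := P.point (i + 1))) (W y).snd)) := by
    rw [riemannSum_tensorMeasure_apply, ← map_sum]
    congr 1
    refine WithLp.ofLp_injective 2 ?_
    rw [WithLp.ofLp_sum, Prod.ext_iff, Prod.fst_sum, Prod.snd_sum]
    simp
  have h2 : ‖(W y).snd‖ ≤ ‖y‖ := by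
    rw [← W.norm_map y, WithLp.prod_norm_eq_of_L2]
    exact Real.le_sqrt_of_sq_le (by nlinarith [sq_nonneg ‖(W y).fst‖])
  rw [h1, W.symm.norm_map, WithLp.norm_toLp_snd]
  refine (norm_sum_tensorIndicator_le hC (p := fun i => (P.point i : ℝ))
    (fun i hi => P.point_le_succ hi) (fun i _ => hF (P.tag i)) _).trans ?_
  gcongr

end RiemannSums

/-! ### The integral equation -/

section IntegralEquation

variable {W : H ≃ₗᵢ[ℂ] HHat}

/-- Matrix elements of `𝔐(B) Y` between exponential vectors. -/
theorem inner_fockMeasure_expVec (hW : IsW W) {B : Set ℝ} (hB : MeasurableSet B) (Y : Op H)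
    (f g : L2Half) :
    ⟪expVec f, (fockMeasure W).toFun B hB Y (expVec g)⟫_ℂ
      = ∫ s in B, innerKernel f g s *
        ⟪expVec (ContinuousLinearMap.adjoint (shift s.toNNReal) f),
          Y (expVec (ContinuousLinearMap.adjoint (shift s.toNNReal) g))⟫_ℂ := by
  have h1 : (fockMeasure W).toFun B hB Y (expVec g) = W.symm (WithLp.toLp 2 (0,
      tensorIndicator Y hB (W (expVec g)).snd)) := rfl
  rw [isW_iff] at hW
  rw [h1, ← W.inner_map_map, W.apply_symm_apply, hW, hW, WithLp.prod_inner_apply]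
  change ⟪(1 : ℂ), 0⟫_ℂ + ⟪annihilated f, tensorIndicator Y hB (annihilated g)⟫_ℂ = _
  rw [inner_zero_right, zero_add, L2.inner_def, ← integral_indicator hB,
    ← integral_indicator measurableSet_Ici]
  refine integral_congr_ae ?_
  filter_upwards [(ae_restrict_iff' measurableSet_Ici).1 (coeFn_annihilated f),
    (ae_restrict_iff' measurableSet_Ici).1 (coeFn_annihilated g),
    (ae_restrict_iff' measurableSet_Ici).1 (coeFn_tensorIndicator Y hB (annihilated g))]
    with s h2 h3 h4
  by_cases hs : s ∈ Ici (0 : ℝ)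
  · rw [indicator_of_mem hs, h2 hs, h4 hs]
    by_cases hsB : s ∈ B
    · rw [indicator_of_mem hsB, indicator_of_mem hsB, h3 hs, map_smul, inner_smul_left,
        inner_smul_right, innerKernel, indicator_of_mem hs, RCLike.inner_apply]
      ring
    · rw [indicator_of_notMem hsB, indicator_of_notMem hsB, inner_zero_right]
  · rw [indicator_of_notMem hs]
    by_cases hsB : s ∈ B
    · rw [indicator_of_mem hsB, innerKernel, indicator_of_notMem hs, zero_mul]
    · rw [indicator_of_notMem hsB]

/-- The function `r ↦ exp(-⟪S_r^* f, S_r^* g⟫) ⟪e(S_r^* f), X e(S_r^* g)⟫`. -/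
def shiftedElement (X : Op H) (f g : L2Half) (r : ℝ≥0) : ℂ :=
  Complex.exp (-⟪ContinuousLinearMap.adjoint (shift r) f,
      ContinuousLinearMap.adjoint (shift r) g⟫_ℂ) *
    ⟪expVec (ContinuousLinearMap.adjoint (shift r) f),
      X (expVec (ContinuousLinearMap.adjoint (shift r) g))⟫_ℂ

theorem continuous_shiftedElement (X : Op H) (f g : L2Half) :
    Continuous (shiftedElement X f g) := by
  have h1 := continuous_adjoint_shift f
  have h2 := continuous_adjoint_shift g
  have h3 := continuous_expVec (μ := halfLine)
  unfold shiftedElement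
  fun_prop

/-- Matrix elements of `𝔐(B) (I ⊗ X)`: the dependence on the splitting time `r` of `I ⊗ X` is
through the argument `s + r` of a continuous function only. -/
theorem inner_fockMeasure_forgetting_expVec (hW : IsW W) {X Z : Op H} {r : ℝ≥0}
    (hZ : IsForgetting r X Z) {B : Set ℝ} (hB : MeasurableSet B) (hB0 : B ⊆ Ici 0)
    (f g : L2Half) :
    ⟪expVec f, (fockMeasure W).toFun B hB Z (expVec g)⟫_ℂ
      = ∫ s in B, innerKernel f g s * Complex.exp (∫ x in Ioi s, innerKernel f g x) *
          shiftedElement X f g (s.toNNReal + r) := by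
  rw [inner_fockMeasure_expVec hW]
  refine setIntegral_congr_fun hB fun s hs => ?_
  have h1 := integral_Ioi_innerKernel s.toNNReal f g
  rw [Real.coe_toNNReal s (hB0 hs)] at h1
  simp only [shiftedElement]
  rw [h1, hZ.inner_expVec, adjoint_shift_adjoint_shift, adjoint_shift_adjoint_shift, sub_eq_add_neg,
    Complex.exp_add]
  ring

theorem inner_riemannSum_expVec (hW : IsW W) {breve : ℝ≥0 → Op H → Op H} {X : Op H}
    (hb : ∀ t, IsForgetting t X (breve t X)) {t : ℝ≥0} (P : TaggedPartition t) (f g : L2Half) :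
    ⟪expVec f, riemannSum (fockMeasure W) (fun s => breve (t - s) X) P (expVec g)⟫_ℂ
      = ∑ i ∈ Finset.range P.n, ∫ s in (P.point i : ℝ)..P.point (i + 1),
          innerKernel f g s * Complex.exp (∫ x in Ioi s, innerKernel f g x) *
            shiftedElement X f g (s.toNNReal + (t - P.tag i)) := by
  rw [riemannSum, _root_.sum_apply, inner_sum]
  refine Finset.sum_congr rfl fun i hi => ?_
  have h1 : (P.point i : ℝ) ≤ P.point (i + 1) := P.point_le_succ (Finset.mem_range.1 hi)
  rw [inner_fockMeasure_forgetting_expVec hW (hb _) _ (fun s hs => (P.point i).2.trans hs.1),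
    integral_Ico_eq_integral_Ioc, intervalIntegral.integral_of_le h1]

/-- The matrix elements of `(I ⊗ X)_t - 𝒯_t(X)`, with `exp(∫₀^∞ k) - exp(∫ₜ^∞ k)`, `k = conj f · g`,
written as an integral over `(0, t)` to be compared with the Riemann sums. -/
theorem inner_sub_noEvent_expVec {T : ℝ≥0 → Op H} {Z X : Op H} {t : ℝ≥0}
    (hT : IsFockShift t (T t)) (hZ : IsForgetting t X Z) (f g : L2Half) :
    ⟪expVec f, (Z - noEvent T t X) (expVec g)⟫_ℂ
      = (∫ s in (0 : ℝ)..t, innerKernel f g s *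
          Complex.exp (∫ x in Ioi s, innerKernel f g x)) * shiftedElement X f g t := by
  rw [integral_mul_exp_tail (integrable_innerKernel f g) (NNReal.coe_nonneg t), integral_Ioi_zero_innerKernel,
    integral_Ioi_innerKernel, _root_.sub_apply, inner_sub_right, hZ.inner_expVec,
    inner_noEvent_expVec hT, shiftedElement, sub_mul, ← mul_assoc, ← mul_assoc, ← Complex.exp_add,
    ← Complex.exp_add, ← sub_eq_add_neg, add_neg_cancel, Complex.exp_zero, one_mul]

/-- Convergence of the Riemann sums on exponential vectors: the integrand is an integrable function
times the value of a continuous function at `s + (t - τᵢ)`, which differs from `t` by at most the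
mesh. -/
theorem tendsto_inner_riemannSum_expVec (hW : IsW W) {T : ℝ≥0 → Op H}
    {breve : ℝ≥0 → Op H → Op H} {X : Op H} {t : ℝ≥0} (hT : IsFockShift t (T t))
    (hb : ∀ t, IsForgetting t X (breve t X)) (f g : L2Half) :
    Tendsto (fun P : TaggedPartition t =>
      ⟪expVec f, (riemannSum (fockMeasure W) (fun s => breve (t - s) X) P
        - (breve t X - noEvent T t X)) (expVec g)⟫_ℂ)
      (TaggedPartition.meshFilter t) (𝓝 0) := by
  let K : ℝ → ℂ := fun s => innerKernel f g s * Complex.exp (∫ x in Ioi s, innerKernel f g x)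
  let G : ℝ≥0 → ℂ := shiftedElement X f g
  have hK : Integrable K := integrable_mul_exp_tail (integrable_innerKernel f g)
  have hG : Continuous G := continuous_shiftedElement X f g
  have hKi : ∀ a b : ℝ, IntervalIntegrable K volume a b := fun _ _ => hK.intervalIntegrable
  have hKG : ∀ (r : ℝ≥0) (a b : ℝ),
      IntervalIntegrable (fun s => K s * G (s.toNNReal + r)) volume a b := fun r a b =>
    (hKi a b).mul_continuousOn (by fun_prop)
  have hdiff : ∀ P : TaggedPartition t,
      ⟪expVec f, (riemannSum (fockMeasure W) (fun s => breve (t - s) X) P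
        - (breve t X - noEvent T t X)) (expVec g)⟫_ℂ
      = ∑ i ∈ Finset.range P.n, ∫ s in (P.point i : ℝ)..P.point (i + 1),
          K s * (G (s.toNNReal + (t - P.tag i)) - G t) := by
    intro P
    have h1 := intervalIntegral.sum_integral_adjacent_intervals (μ := volume) (f := K)
      (a := fun i => (P.point i : ℝ)) (n := P.n) fun i _ => hKi _ _
    rw [P.point_zero, P.point_last, NNReal.coe_zero] at h1
    rw [_root_.sub_apply, inner_sub_right, inner_riemannSum_expVec hW hb,
      inner_sub_noEvent_expVec hT (hb t), ← h1, Finset.sum_mul, ← Finset.sum_sub_distrib]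
    refine Finset.sum_congr rfl fun i _ => ?_
    rw [← intervalIntegral.integral_mul_const,
      ← intervalIntegral.integral_sub (hKG _ _ _) ((hKi _ _).mul_const _)]
    simp only [mul_sub, K, G]
  rw [Metric.tendsto_nhds]
  intro ε hε
  set I : ℝ := ∫ s in (0 : ℝ)..t, ‖K s‖ with hI
  have hI0 : 0 ≤ I := intervalIntegral.integral_nonneg t.2 fun _ _ => norm_nonneg _
  obtain ⟨δ, hδ, hGδ⟩ := Metric.continuous_iff.1 hG t (ε / (I + 1)) (by positivity)
  lift δ to ℝ≥0 using hδ.le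
  refine (TaggedPartition.hasBasis_meshFilter t).eventually_iff.2 ⟨δ, hδ, fun P hP => ?_⟩
  replace hP := (P.mesh_lt_iff hδ).1 hP
  rw [dist_zero_right, hdiff]
  have h2 := intervalIntegral.sum_integral_adjacent_intervals (μ := volume)
    (f := fun s => ‖K s‖) (a := fun i => (P.point i : ℝ)) (n := P.n) fun i _ => (hKi _ _).norm
  rw [P.point_zero, P.point_last, NNReal.coe_zero] at h2
  calc ‖∑ i ∈ Finset.range P.n, ∫ s in (P.point i : ℝ)..P.point (i + 1),
          K s * (G (s.toNNReal + (t - P.tag i)) - G t)‖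
      ≤ ∑ i ∈ Finset.range P.n, ∫ s in (P.point i : ℝ)..P.point (i + 1),
          ‖K s‖ * (ε / (I + 1)) := by
        refine norm_sum_le_of_le _ fun i hi => ?_
        have hi' := Finset.mem_range.1 hi
        refine intervalIntegral.norm_integral_le_of_norm_le (P.point_le_succ hi') ?_
          ((hKi _ _).norm.mul_const _)
        refine Eventually.of_forall fun s hs => ?_
        rw [norm_mul]
        gcongr
        have h3 : (0 : ℝ) ≤ s := (P.point i).2.trans hs.1.le
        have h4 : (P.point i : ℝ) ≤ P.tag i := (P.tag_mem i hi').1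
        have h5 : (P.tag i : ℝ) ≤ P.point (i + 1) := (P.tag_mem i hi').2
        have h6 := hP i hi'
        have h7 : dist (s.toNNReal + (t - P.tag i)) t < δ := by
          rw [NNReal.dist_eq, NNReal.coe_add, NNReal.coe_sub (P.tag_le hi'),
            Real.coe_toNNReal s h3, abs_lt]
          constructor <;> linarith [hs.1, hs.2]
        rw [← dist_eq_norm]
        exact (hGδ _ h7).le
    _ = I * (ε / (I + 1)) := by
        rw [hI, ← h2, Finset.sum_mul]
        refine Finset.sum_congr rfl fun i _ => ?_
        rw [intervalIntegral.integral_mul_const]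
    _ < (I + 1) * (ε / (I + 1)) := by
        gcongr
        linarith
    _ = ε := by field_simp

/-- `∫₀ᵗ 𝔐(ds) (I ⊗ X)_{t-s} = (I ⊗ X)_t - 𝒯_t(X)`. -/
theorem hasIntegral_forgetting (hW : IsW W) {T : ℝ≥0 → Op H} {breve : ℝ≥0 → Op H → Op H}
    {X : Op H} {t : ℝ≥0} (hT : IsFockShift t (T t)) (hb : ∀ t, IsForgetting t X (breve t X)) :
    HasIntegral (fockMeasure W) (fun s => breve (t - s) X) t (breve t X - noEvent T t X) := by
  refine hasIntegral_of_tendsto fun ξ η hξ hη => ?_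
  refine tendsto_tsum_inner_of_dense_span (C := ‖X‖ + ‖breve t X - noEvent T t X‖) (fun P => ?_)
    (dense_span_expVec (μ := halfLine))
    (fun f g => tendsto_inner_riemannSum_expVec hW hT hb f g) hξ hη
  refine (norm_sub_le _ _).trans ?_
  gcongr
  exact norm_riemannSum_le W (norm_nonneg X) (fun s => (hb _).norm_le) P

end IntegralEquation

/-! ### Transport by a unitary -/

section Transport

variable {K K' : Type*} [NormedAddCommGroup K] [InnerProductSpace ℂ K]
  [NormedAddCommGroup K'] [InnerProductSpace ℂ K']

theorem conjBy_symm_conjBy (W : K ≃ₗᵢ[ℂ] K') (X : Op K) : conjBy W.symm (conjBy W X) = X := by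
  ext y
  simp [conjBy]

theorem HasIntegral.transport {M : OperatorMeasure K} {F : ℝ≥0 → Op K} {t : ℝ≥0} {A : Op K}
    (h : HasIntegral M F t A) (W : K ≃ₗᵢ[ℂ] K') :
    HasIntegral (M.transport W) (fun s => conjBy W (F s)) t (conjBy W A) := by
  intro ξ η hξ hη ε hε
  obtain ⟨δ, hδ, hP⟩ := h (fun k => W.symm (ξ k)) (fun k => W.symm (η k))
    (by simpa using hξ) (by simpa using hη) ε hε
  refine ⟨δ, hδ, fun P hmesh => ?_⟩
  have h1 : riemannSum (M.transport W) (fun s => conjBy W (F s)) P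
      = conjBy W (riemannSum M F P) := by
    simp only [riemannSum, map_sum]
    refine Finset.sum_congr rfl fun i _ => ?_
    change conjBy W (M.toFun _ _ (conjBy W.symm (conjBy W (F (P.tag i))))) = _
    rw [conjBy_symm_conjBy]
  have h2 : ∀ k, ⟪ξ k, riemannSum (M.transport W) (fun s => conjBy W (F s)) P (η k)
      - conjBy W A (η k)⟫_ℂ
      = ⟪W.symm (ξ k), riemannSum M F P (W.symm (η k)) - A (W.symm (η k))⟫_ℂ := by
    intro k
    rw [h1, ← W.symm.inner_map_map, map_sub]
    simp [conjBy, inner_sub_right]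
  simp_rw [h2]
  exact hP P hmesh

end Transport

end FockShift

end

theorem proposition7 :
    (∀ t : NNReal, ∃! T : FockShift.Op FockShift.H, FockShift.IsFockShift t T) ∧
    (∀ (t : NNReal) (X : FockShift.Op FockShift.H),
      ∃! Z : FockShift.Op FockShift.H, FockShift.IsForgetting t X Z) ∧
    (∃! W : FockShift.H ≃ₗᵢ[ℂ] FockShift.HHat, FockShift.IsW W) ∧
    ∀ (T : NNReal → FockShift.Op FockShift.H)
      (breve : NNReal → FockShift.Op FockShift.H → FockShift.Op FockShift.H)
      (W : FockShift.H ≃ₗᵢ[ℂ] FockShift.HHat),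
      (∀ t, FockShift.IsFockShift t (T t)) →
      (∀ t X, FockShift.IsForgetting t X (breve t X)) →
      FockShift.IsW W →
      (∀ (t : NNReal) (X : FockShift.Op FockShift.H),
        ∃ A : FockShift.Op FockShift.H,
          FockShift.HasIntegral (FockShift.fockMeasure W) (fun s => breve (t - s) X) t A ∧
          breve t X - A = FockShift.noEvent T t X) ∧
      (∀ (t : NNReal) (X : FockShift.Op FockShift.HHat),
        ∃ A : FockShift.Op FockShift.HHat,
          FockShift.HasIntegral ((FockShift.fockMeasure W).transport W)
            (fun s => FockShift.transport W (breve (t - s)) X) t A ∧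
          FockShift.transport W (breve t) X - A =
            FockShift.transport W (FockShift.noEvent T t) X) := by
  refine ⟨FockShift.existsUnique_isFockShift, FockShift.existsUnique_isForgetting,
    FockShift.existsUnique_isW, fun T breve W hT hb hW => ⟨fun t X => ?_, fun t X => ?_⟩⟩
  · exact ⟨_, FockShift.hasIntegral_forgetting hW (hT t) (fun s => hb s X), sub_sub_cancel _ _⟩
  · let Y := FockShift.conjBy W.symm X
    refine ⟨_, (FockShift.hasIntegral_forgetting hW (hT t) (fun s => hb s Y)).transport W, ?_⟩
    rw [map_sub]
    exact sub_sub_cancel _ _
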